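/- Let $n\ge 5$ and let $G_n$ be a simple plane triangulation with $2n+2$ vertices which has two non-adjacent vertices $a,b$ of degree $n$ (the poles) and whose other $2n$ vertices have degree $5$, no vertex being adjacent to both poles. Let $H_n=G_n-b$. A Kempe change of a $4$-colouring $A$ (a proper colouring with colours $1,2,3,4$) swaps two colours $i\ne j$ on one component of the subgraph induced by the vertices coloured $i$ or $j$. Two $4$-colourings $A,B$ are called equal if $A=P\circ B$ for some permutation $P$ of $\{1,2,3,4\}$; numbers of Kempe changes are counted up to equality, that is, $A$ and $B$ are equivalent within $m$ Kempe changes if some colouring equal to $B$ is obtained from $A$ by a series of at most $m$ Kempe changes. **Theorem 2.1.** Any two $4$-colourings of $H_n$ are equivalent within - $6\lfloor n/2\rfloor$ Kempe changes if $n\equiv 0\pmod 3$, - $9\lfloor n/2\rfloor$ Kempe changes if $n\equiv 2\pmod 3$, - $9\lfloor n/2\rfloor+6\lfloor n/3\rfloor-2$ Kempe changes if $n\equiv 1\pmod 3$. In particular, any two $4$-colourings of $H_n$ are equivalent within $\lfloor 13n/2\rfloor$ Kempe changes, and all $4$-colourings of $H_n$ form one Kempe class: each can be obtained from any other (exactly,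 not only up to a permutation of the colours) by a finite series of Kempe changes. -/

import Mathlib

namespace KempeH

/-! ### Plane triangulations, through rotation systems -/

/-- A combinatorial embedding of a simple graph in an oriented closed surface: a permutation of the
darts (oriented edges) which, at every vertex, cyclically permutes the darts leaving that vertex. -/
structure RotationSystem {V : Type*} (G : SimpleGraph V) where
  rot : Equiv.Perm G.Dart
  fst_rot : ∀ d : G.Dart, (rot d).fst = d.fst
  sameCycle : ∀ d d' : G.Dart, d.fst = d'.fst → rot.SameCycle d d'

/-- The reversal of darts, as a permutation. -/
def dartRev {V : Type*} (G : SimpleGraph V) : Equiv.Perm G.Dart :=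
  Function.Involutive.toPerm SimpleGraph.Dart.symm SimpleGraph.Dart.symm_involutive

/-- The face permutation: go along a dart, then turn to the next dart at its head.
Its cycles are the facial walks. -/
def RotationSystem.face {V : Type*} {G : SimpleGraph V} (R : RotationSystem G) :
    Equiv.Perm G.Dart :=
  R.rot * dartRev G

/-- The faces of the embedding: the cycles of the face permutation. -/
def RotationSystem.Faces {V : Type*} {G : SimpleGraph V} (R : RotationSystem G) : Type _ :=
  Quotient (Equiv.Perm.SameCycle.setoid R.face)

/-- `G` is a simple plane triangulation: it is connected and it has an embedding in the
sphere (Euler's formula `|V| - |E| + |F| = 2`) all of whose faces are bounded by three edges. -/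
def IsPlaneTriangulation {V : Type*} [Finite V] (G : SimpleGraph V) : Prop :=
  G.Connected ∧ ∃ R : RotationSystem G,
    (Nat.card V : ℤ) - (Nat.card G.edgeSet : ℤ) + (Nat.card R.Faces : ℤ) = 2 ∧
    ∀ d : G.Dart, {d' : G.Dart | R.face.SameCycle d d'}.ncard = 3

/-- `G` is the triangulation `G_n` with poles `a` and `b`: a simple plane triangulation with two
non-adjacent vertices `a`, `b` of degree `n`, whose other vertices are `2n` vertices of degree `5`,
no vertex being adjacent to both poles. -/
structure IsPolarTriangulation {V : Type*} [Fintype V] (G : SimpleGraph V) [DecidableRel G.Adj]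
    (n : ℕ) (a b : V) : Prop where
  triangulation : IsPlaneTriangulation G
  ne : a ≠ b
  not_adj : ¬ G.Adj a b
  degree_a : G.degree a = n
  degree_b : G.degree b = n
  degree_other : ∀ v : V, v ≠ a → v ≠ b → G.degree v = 5
  card : Fintype.card V = 2 * n + 2
  no_common_neighbour : ∀ v : V, ¬ (G.Adj a v ∧ G.Adj b v)

/-- The graph `G - b`. -/
abbrev deleteVertex {V : Type*} (G : SimpleGraph V) (b : V) : SimpleGraph {v : V // v ≠ b} :=
  G.induce {v : V | v ≠ b}

/-! ### Kempe changes -/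

/-- The vertices coloured `i` or `j` by `A`. -/
def bicoloured {V : Type*} {G : SimpleGraph V} {α : Type*} (A : G.Coloring α) (i j : α) : Set V :=
  {v | A v = i ∨ A v = j}

/-- `K` is (the vertex set of) a Kempe chain of `A` in the colours `i`, `j`: a component of the
subgraph induced by the vertices coloured `i` or `j`. -/
def IsKempeChain {V : Type*} {G : SimpleGraph V} {α : Type*} (A : G.Coloring α) (i j : α)
    (K : Set V) : Prop :=
  ∃ C : (G.induce (bicoloured A i j)).ConnectedComponent, K = Subtype.val '' C.supp

/-- `B` is obtained from `A` by swapping the two colours in one Kempe chain. -/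
def KempeChange {V : Type*} {G : SimpleGraph V} {α : Type*} [DecidableEq α]
    (A B : G.Coloring α) : Prop :=
  ∃ i j : α, i ≠ j ∧ ∃ K : Set V, IsKempeChain A i j K ∧
    (∀ v ∈ K, B v = Equiv.swap i j (A v)) ∧ ∀ v ∉ K, B v = A v

/-- `KempeSteps k A B`: `B` is obtained from `A` by a series of exactly `k` Kempe changes. -/
inductive KempeSteps {V : Type*} {G : SimpleGraph V} {α : Type*} [DecidableEq α] :
    ℕ → G.Coloring α → G.Coloring α → Prop
  | refl (A : G.Coloring α) : KempeSteps 0 A A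
  | step {k : ℕ} {A B C : G.Coloring α} :
      KempeSteps k A B → KempeChange B C → KempeSteps (k + 1) A C

/-- Kempe equivalence: `B` is obtained from `A` by a finite series of Kempe changes. -/
def KempeEquivalent {V : Type*} {G : SimpleGraph V} {α : Type*} [DecidableEq α]
    (A B : G.Coloring α) : Prop :=
  ∃ k : ℕ, KempeSteps k A B

/-- Two colourings are equal up to a permutation of the colours. -/
def EqualUpToPerm {V : Type*} {G : SimpleGraph V} {α : Type*} (A B : G.Coloring α) : Prop :=
  ∃ P : Equiv.Perm α, ∀ v : V, A v = P (B v)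

/-- `A` and `B` are Kempe equivalent within at most `m` Kempe changes, where colourings that
differ by a permutation of the colours are identified. -/
def KempeEquivalentWithin {V : Type*} {G : SimpleGraph V} {α : Type*} [DecidableEq α]
    (m : ℕ) (A B : G.Coloring α) : Prop :=
  ∃ k : ℕ, k ≤ m ∧ ∃ B' : G.Coloring α, KempeSteps k A B' ∧ EqualUpToPerm B' B

end KempeH

/-! The degrees and the triangular faces determine the graph. The neighbours u_i of `a` form an
n-cycle (the rim), the neighbours w_i of `b` form another, and w_i is joined to u_i and u_{i+1}. So
`H = G - b` is the square of the 2n-cycle u_0 w_0 u_1 w_1 ... together with `a`, joined to the even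
places (`exists_isStrip`).

Call the colour of `a` `none` and the other three the elements of `ZMod 3`. Each rim edge then has
slope 1 or -1, and w_i either has the colour of `a` (a mark) or is forced to the third colour at its
rim edge. No two adjacent places are marked, and the slope can change only at a cut vertex, a rim
vertex next to a mark. Up to renaming, a colouring is its sequence of slopes, up to a global sign,
and its set of marks.

Two kinds of Kempe change suffice. A flip (`exists_flip`) negates the slopes between two cut
vertices of equal colour with no cut vertex of that colour between them. A toggle (`exists_toggle`)
exchanges marked and unmarked places in a maximal run of outer vertices whose rim edges miss the
same colour.

The main lemma is `exists_sweep`: an arc between cut vertices whose end colours are compatible with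
a constant slope is given that slope by at most as many flips as it has cut vertices. One of its two
ends can always be straightened by at most one flip (`not_both_stuck`). Marks inside the uniform arc
are then removed singly (`exists_clear`). There are at most ⌊n/2⌋ marks, hence 2⌊n/2⌋ cut vertices,
so about 3⌊n/2⌋ changes lead to a normal form.

The slopes sum to 0 modulo 3. For n ≡ 0 all slopes can be equal, and the normal form is unique. For
n ≡ 2 one edge is exceptional, and for n ≡ 1 two consecutive ones are; these normal forms are unique
up to rotation. A rotation by one place costs 3 or 4 changes, and at most ⌊n/2⌋ rotations are
needed. Finally, a permutation of the colours is itself a series of Kempe changes, which gives exact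
equivalence. -/

namespace KempeH

/-! ### Kempe changes in general graphs -/

section Generic
variable {V : Type*} {G : SimpleGraph V} {α β : Type*}

theorem isKempeChain_congr {A : G.Coloring α} {B : G.Coloring β} {i j : α} {i' j' : β} {K : Set V}
    (h : bicoloured A i j = bicoloured B i' j') (hK : IsKempeChain A i j K) :
    IsKempeChain B i' j' K := by
  unfold IsKempeChain at *
  rw [← h]
  exact hK

/-- A nonempty set of bicoloured vertices that is closed under adjacency and connected
is a Kempe chain. -/
theorem isKempeChain_of_reachable {A : G.Coloring α} {i j : α} {K : Set V}
    (r : bicoloured A i j) (hK : K ⊆ bicoloured A i j) (hr : r.1 ∈ K)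
    (hconn : ∀ v (hv : v ∈ K), (G.induce (bicoloured A i j)).Reachable r ⟨v, hK hv⟩)
    (hclosed : ∀ v ∈ K, ∀ v' ∈ bicoloured A i j, G.Adj v v' → v' ∈ K) :
    IsKempeChain A i j K := by
  refine ⟨(G.induce (bicoloured A i j)).connectedComponentMk r, ?_⟩
  ext v
  simp only [Set.mem_image, SimpleGraph.ConnectedComponent.mem_supp_iff,
    SimpleGraph.ConnectedComponent.eq]
  constructor
  · intro hv
    exact ⟨⟨v, hK hv⟩, (hconn v hv).symm, rfl⟩
  · rintro ⟨y, ⟨p⟩, rfl⟩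
    induction p with
    | nil => exact hr
    | cons h p ih => exact hclosed _ (ih hr (fun v hv => (hconn v hv))) _ (Subtype.property _) h.symm

variable [DecidableEq α] [DecidableEq β]

open Classical in
/-- The result of swapping two colours on a Kempe chain. -/
theorem exists_kempeChange {A : G.Coloring α} {i j : α} (hij : i ≠ j) {K : Set V}
    (hK : IsKempeChain A i j K) :
    ∃ B : G.Coloring α, KempeChange A B ∧ (∀ v ∈ K, B v = Equiv.swap i j (A v)) ∧
      ∀ v ∉ K, B v = A v := by
  have hsub : K ⊆ bicoloured A i j := by
    obtain ⟨C, rfl⟩ := hK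
    rintro _ ⟨y, -, rfl⟩
    exact y.2
  have hclosed : ∀ v ∈ K, ∀ v' ∈ bicoloured A i j, G.Adj v v' → v' ∈ K := by
    obtain ⟨C, rfl⟩ := hK
    rintro _ ⟨y, hy, rfl⟩ v' hv' hadj
    refine ⟨⟨v', hv'⟩, ?_, rfl⟩
    exact (SimpleGraph.ConnectedComponent.mem_supp_congr_adj C (v := y) (w := ⟨v', hv'⟩) hadj).1 hy
  have hsw : ∀ v v', G.Adj v v' → v ∈ K → v' ∉ K → Equiv.swap i j (A v) ≠ A v' := by
    intro v v' hadj hv hv' he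
    have h1 := hsub hv
    apply hv'
    apply hclosed v hv v' _ hadj
    rcases h1 with h1 | h1 <;> rw [h1] at he <;> simp at he <;> simp [bicoloured, ← he]
  let B : G.Coloring α := SimpleGraph.Coloring.mk
    (fun v => if v ∈ K then Equiv.swap i j (A v) else A v) (by
      intro v v' hadj
      have hne := A.valid hadj
      by_cases hv : v ∈ K <;> by_cases hv' : v' ∈ K <;> simp only [hv, hv', if_true, if_false]
      · exact fun h => hne ((Equiv.swap i j).injective h)
      · exact hsw v v' hadj hv hv'
      · exact (hsw v' v hadj.symm hv' hv).symm
      · exact hne)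
  have h1 : ∀ v ∈ K, B v = Equiv.swap i j (A v) := fun v hv => if_pos hv
  have h2 : ∀ v ∉ K, B v = A v := fun v hv => if_neg hv
  exact ⟨B, ⟨i, j, hij, K, hK, h1, h2⟩, h1, h2⟩

theorem bicoloured_eq_of_swap {A B : G.Coloring α} {i j : α} {K : Set V}
    (h1 : ∀ v ∈ K, B v = Equiv.swap i j (A v)) (h2 : ∀ v ∉ K, B v = A v) :
    bicoloured A i j = bicoloured B i j := by
  ext v
  by_cases hv : v ∈ K
  · simp only [bicoloured, Set.mem_ofPred_eq, h1 v hv, Equiv.swap_apply_eq_iff,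
      Equiv.swap_apply_left, Equiv.swap_apply_right]
    tauto
  · simp only [bicoloured, Set.mem_ofPred_eq, h2 v hv]

theorem KempeChange.symm {A B : G.Coloring α} (h : KempeChange A B) : KempeChange B A := by
  obtain ⟨i, j, hij, K, hK, h1, h2⟩ := h
  refine ⟨i, j, hij, K, isKempeChain_congr (bicoloured_eq_of_swap h1 h2) hK, ?_, ?_⟩
  · intro v hv
    rw [h1 v hv, Equiv.swap_apply_self]
  · intro v hv
    rw [h2 v hv]

/-- Renaming the colours of a colouring. -/
def recolour (P : α ≃ β) (A : G.Coloring α) : G.Coloring β :=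
  SimpleGraph.Coloring.mk (fun v => P (A v)) (fun h e => A.valid h (P.injective e))

omit [DecidableEq α] [DecidableEq β] in
@[simp] theorem recolour_apply (P : α ≃ β) (A : G.Coloring α) (v : V) :
    recolour P A v = P (A v) := rfl

theorem KempeChange.recolour {A B : G.Coloring α} (P : α ≃ β) (h : KempeChange A B) :
    KempeChange (recolour P A) (recolour P B) := by
  obtain ⟨i, j, hij, K, hK, h1, h2⟩ := h
  refine ⟨P i, P j, P.injective.ne hij, K, isKempeChain_congr ?_ hK, ?_, ?_⟩
  · ext v
    simp [bicoloured]
  · intro v hv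
    simp only [recolour_apply, h1 v hv]
    exact P.injective.map_swap _ _ _
  · intro v hv
    simp [h2 v hv]

theorem KempeSteps.recolour {A B : G.Coloring α} (P : α ≃ β) {k : ℕ} (h : KempeSteps k A B) :
    KempeSteps k (recolour P A) (recolour P B) := by
  induction h with
  | refl A => exact .refl _
  | step _ h ih => exact .step ih (h.recolour P)

theorem KempeSteps.trans {A B C : G.Coloring α} {k l : ℕ} (h : KempeSteps k A B)
    (h' : KempeSteps l B C) : KempeSteps (k + l) A C := by
  induction h' with
  | refl A => exact h
  | step _ hc ih => exact .step (ih h) hc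

theorem KempeChange.steps {A B : G.Coloring α} (h : KempeChange A B) : KempeSteps 1 A B :=
  .step (.refl A) h

theorem KempeSteps.symm {A B : G.Coloring α} {k : ℕ} (h : KempeSteps k A B) :
    KempeSteps k B A := by
  induction h with
  | refl A => exact .refl _
  | @step k A B C _ hc ih =>
    rw [add_comm]
    exact hc.symm.steps.trans ih

/-- `B` is obtained from `A` by at most `m` Kempe changes. -/
def KempeWithin (m : ℕ) (A B : G.Coloring α) : Prop := ∃ k ≤ m, KempeSteps k A B

theorem KempeWithin.refl (A : G.Coloring α) : KempeWithin 0 A A := ⟨0, le_rfl, .refl A⟩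

theorem KempeWithin.trans {A B C : G.Coloring α} {m m' : ℕ} (h : KempeWithin m A B)
    (h' : KempeWithin m' B C) : KempeWithin (m + m') A C := by
  obtain ⟨k, hk, h⟩ := h
  obtain ⟨l, hl, h'⟩ := h'
  exact ⟨k + l, by omega, h.trans h'⟩

theorem KempeWithin.symm {A B : G.Coloring α} {m : ℕ} (h : KempeWithin m A B) :
    KempeWithin m B A := by
  obtain ⟨k, hk, h⟩ := h
  exact ⟨k, hk, h.symm⟩

theorem KempeWithin.mono {A B : G.Coloring α} {m m' : ℕ} (h : KempeWithin m A B) (hm : m ≤ m') :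
    KempeWithin m' A B := by
  obtain ⟨k, hk, h⟩ := h
  exact ⟨k, hk.trans hm, h⟩

theorem KempeChange.within {A B : G.Coloring α} (h : KempeChange A B) : KempeWithin 1 A B :=
  ⟨1, le_rfl, h.steps⟩

omit [DecidableEq α] in
theorem EqualUpToPerm.symm {A B : G.Coloring α} (h : EqualUpToPerm A B) : EqualUpToPerm B A := by
  obtain ⟨P, hP⟩ := h
  exact ⟨P⁻¹, fun v => by simp [hP]⟩

/-- Two colourings meet if both are led to the same colouring, up to a permutation. -/
theorem kempeEquivalentWithin_of_meet {A B A' B' : G.Coloring α} {m m' : ℕ}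
    (hA : KempeWithin m A A') (hB : KempeWithin m' B B') (h : EqualUpToPerm A' B') :
    KempeEquivalentWithin (m + m') A B := by
  obtain ⟨k, hk, hA⟩ := hA
  obtain ⟨l, hl, hB⟩ := hB
  obtain ⟨P, hP⟩ := h
  have e : A' = KempeH.recolour P B' := by
    ext v
    simp [hP]
  refine ⟨k + l, by omega, KempeH.recolour P B, ?_, P, fun v => rfl⟩
  rw [e] at hA
  exact hA.trans (hB.recolour P).symm

theorem KempeEquivalentWithin.mono {A B : G.Coloring α} {m m' : ℕ}
    (h : KempeEquivalentWithin m A B) (hm : m ≤ m') : KempeEquivalentWithin m' A B := by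
  obtain ⟨k, hk, h⟩ := h
  exact ⟨k, hk.trans hm, h⟩

/-- The final permutation absorbs any renaming, so the colours of `A` and of `B` may be renamed
independently. This is what allows `a` to have the colour `none` in both. -/
theorem KempeEquivalentWithin.of_recolour {A B : G.Coloring α} {m : ℕ} (P Q : α ≃ β)
    (h : KempeEquivalentWithin m (KempeH.recolour P A) (KempeH.recolour Q B)) :
    KempeEquivalentWithin m A B := by
  obtain ⟨k, hk, B', hs, R, hR⟩ := h
  refine ⟨k, hk, KempeH.recolour P.symm B', ?_, (Q.trans R).trans P.symm, ?_⟩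
  · have := hs.recolour P.symm
    have e : KempeH.recolour P.symm (KempeH.recolour P A) = A := by
      ext v
      simp
    rwa [e] at this
  · intro v
    simp [hR]

theorem KempeEquivalent.trans {A B C : G.Coloring α} (h : KempeEquivalent A B)
    (h' : KempeEquivalent B C) : KempeEquivalent A C := by
  obtain ⟨k, h⟩ := h
  obtain ⟨l, h'⟩ := h'
  exact ⟨k + l, h.trans h'⟩

/-- Swapping two colours everywhere is a series of Kempe changes, one for each chain. -/
theorem kempeEquivalent_recolour_swap [Finite V] (A : G.Coloring α) (i j : α) (hij : i ≠ j) :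
    KempeEquivalent A (KempeH.recolour (Equiv.swap i j) A) := by
  classical
  -- The chains are swapped one at a time: swapping some of them keeps the set of bicoloured
  -- vertices, so the others are still chains of the new colouring.
  have key : ∀ T : Finset (G.induce (bicoloured A i j)).ConnectedComponent,
      ∃ B : G.Coloring α, KempeEquivalent A B ∧
        (∀ v : bicoloured A i j, (G.induce (bicoloured A i j)).connectedComponentMk v ∈ T →
          B v = Equiv.swap i j (A v)) ∧
        (∀ v : bicoloured A i j, (G.induce (bicoloured A i j)).connectedComponentMk v ∉ T →
          B v = A v) ∧ (∀ v ∉ bicoloured A i j, B v = A v) := by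
    intro T
    induction T using Finset.induction_on with
    | empty => exact ⟨A, ⟨0, .refl A⟩, by simp, by simp, by simp⟩
    | insert C T hC ih =>
      obtain ⟨B, hB, h1, h2, h3⟩ := ih
      have hbic : bicoloured A i j = bicoloured B i j := by
        apply bicoloured_eq_of_swap
          (K := {v | ∃ h : v ∈ bicoloured A i j,
            (G.induce (bicoloured A i j)).connectedComponentMk ⟨v, h⟩ ∈ T})
        · rintro v ⟨hv, hT⟩
          exact h1 ⟨v, hv⟩ hT
        · intro v hv
          by_cases h : v ∈ bicoloured A i j
          · exact h2 ⟨v, h⟩ fun hT => hv ⟨h, hT⟩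
          · exact h3 v h
      have hK : IsKempeChain B i j (Subtype.val '' C.supp) := isKempeChain_congr hbic ⟨C, rfl⟩
      obtain ⟨B', hBB', hin, hout⟩ := exists_kempeChange hij hK
      have mem : ∀ v : bicoloured A i j, (v : V) ∈ Subtype.val '' C.supp ↔
          (G.induce (bicoloured A i j)).connectedComponentMk v = C := by
        intro v
        simp [SimpleGraph.ConnectedComponent.mem_supp_iff]
      refine ⟨B', hB.trans ⟨1, hBB'.steps⟩, ?_, ?_, ?_⟩
      · intro v hv
        rcases Finset.mem_insert.1 hv with hv | hv
        · rw [hin _ ((mem v).2 hv), h2 v (hv ▸ hC)]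
        · rw [hout _ (fun h => hC ((mem v).1 h ▸ hv)), h1 v hv]
      · intro v hv
        rw [Finset.mem_insert, not_or] at hv
        rw [hout _ (fun h => hv.1 ((mem v).1 h)), h2 v hv.2]
      · intro v hv
        rw [hout _ ?_, h3 v hv]
        rintro ⟨y, -, rfl⟩
        exact hv y.2
  have : Finite (G.induce (bicoloured A i j)).ConnectedComponent := inferInstance
  have := Fintype.ofFinite (G.induce (bicoloured A i j)).ConnectedComponent
  obtain ⟨B, hB, h1, -, h3⟩ := key Finset.univ
  have e : B = KempeH.recolour (Equiv.swap i j) A := by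
    ext v
    by_cases hv : v ∈ bicoloured A i j
    · exact h1 ⟨v, hv⟩ (Finset.mem_univ _)
    · rw [h3 v hv, recolour_apply]
      simp only [bicoloured, Set.mem_ofPred_eq, not_or] at hv
      rw [Equiv.swap_apply_of_ne_of_ne hv.1 hv.2]
  exact e ▸ hB

theorem kempeEquivalent_recolour [Finite V] [Finite α] (P : Equiv.Perm α) (A : G.Coloring α) :
    KempeEquivalent A (KempeH.recolour P A) := by
  induction P using Equiv.Perm.swap_induction_on with
  | one => exact ⟨0, .refl A⟩
  | swap_mul f x y hxy ih =>
    exact ih.trans (kempeEquivalent_recolour_swap (KempeH.recolour f A) x y hxy)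

theorem KempeEquivalentWithin.kempeEquivalent [Finite V] [Finite α] {A B : G.Coloring α} {m : ℕ}
    (h : KempeEquivalentWithin m A B) : KempeEquivalent A B := by
  obtain ⟨k, -, B', hs, hP⟩ := h
  obtain ⟨P, hP⟩ := hP.symm
  have e : B = KempeH.recolour P B' := by
    ext v
    simp [hP]
  exact KempeEquivalent.trans ⟨k, hs⟩ (e ▸ kempeEquivalent_recolour P B')

end Generic
end KempeH
-- The strip, its colourings, and the two basic moves
namespace KempeH

/-- The graph `H` is the square of the cycle `z 0, …, z (2n-1)` together with a vertex `a` joined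
to the vertices with even index. -/
structure IsStrip {W : Type*} (H : SimpleGraph W) (n : ℕ) (a : W) (z : ℤ → W) : Prop where
  five_le : 5 ≤ n
  periodic : ∀ t, z (t + 2 * n) = z t
  dvd_of_eq : ∀ s t, z s = z t → (2 * n : ℤ) ∣ s - t
  ne : ∀ t, z t ≠ a
  surj : ∀ v, v = a ∨ ∃ t, v = z t
  adj : ∀ t v, H.Adj (z t) v ↔
    v = a ∧ Even t ∨ v = z (t + 1) ∨ v = z (t - 1) ∨ v = z (t + 2) ∨ v = z (t - 2)

section Strip
variable {W : Type*} {H : SimpleGraph W} {n : ℕ} {a : W} {z : ℤ → W}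

/-- Kempe chains which avoid `a` are intervals of the cycle. -/
theorem IsStrip.isKempeChain (hz : IsStrip H n a z) {α : Type*} {A : H.Coloring α} {i j : α}
    {p q : ℤ} (hne : ∃ t, p ≤ t ∧ t ≤ q ∧ z t ∈ bicoloured A i j)
    (hgap : ∀ t, p ≤ t → t < q → z t ∈ bicoloured A i j ∨ z (t + 1) ∈ bicoloured A i j)
    (hclosed : ∀ t, p ≤ t → t ≤ q → z t ∈ bicoloured A i j → ∀ v ∈ bicoloured A i j,
      H.Adj (z t) v → ∃ t', p ≤ t' ∧ t' ≤ q ∧ v = z t') :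
    IsKempeChain A i j {v | v ∈ bicoloured A i j ∧ ∃ t, p ≤ t ∧ t ≤ q ∧ v = z t} := by
  have adj1 : ∀ t, H.Adj (z t) (z (t + 1)) := fun t => (hz.adj _ _).2 (by simp)
  have adj2 : ∀ t, H.Adj (z t) (z (t + 2)) := fun t => (hz.adj _ _).2 (by simp)
  -- From a bicoloured place the chain advances by one or two places, both being adjacent; `hgap`
  -- excludes two consecutive misses.
  have key : ∀ k : ℕ, ∀ t, p ≤ t → t + k ≤ q → ∀ (h : z t ∈ bicoloured A i j)
      (h' : z (t + k) ∈ bicoloured A i j),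
      (H.induce (bicoloured A i j)).Reachable ⟨z t, h⟩ ⟨z (t + k), h'⟩ := by
    intro k
    induction k using Nat.strong_induction_on with
    | _ k ih =>
      intro t hp hq h h'
      obtain rfl | rfl | ⟨l, rfl⟩ : k = 0 ∨ k = 1 ∨ ∃ l, k = l + 2 := by
        rcases k with _ | _ | l
        · simp
        · simp
        · exact Or.inr (Or.inr ⟨l, rfl⟩)
      · simp only [Nat.cast_zero, add_zero]
        exact SimpleGraph.Reachable.refl _
      · apply SimpleGraph.Adj.reachable
        simpa using adj1 t
      · rcases hgap (t + 1) (by omega) (by push_cast at hq; omega) with h1 | h1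
        · have e : z (t + 1 + ((l + 1 : ℕ) : ℤ)) = z (t + ((l + 2 : ℕ) : ℤ)) := by
            congr 1; push_cast; ring
          have r := ih (l + 1) (by omega) (t + 1) (by omega) (by push_cast at hq ⊢; omega) h1
            (e ▸ h')
          simp only [e] at r
          refine SimpleGraph.Reachable.trans (SimpleGraph.Adj.reachable ?_) r
          exact adj1 t
        · rw [add_assoc, one_add_one_eq_two] at h1
          have e : z (t + 2 + (l : ℤ)) = z (t + ((l + 2 : ℕ) : ℤ)) := by
            congr 1; push_cast; ring
          have r := ih l (by omega) (t + 2) (by omega) (by push_cast at hq; omega) h1 (e ▸ h')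
          simp only [e] at r
          refine SimpleGraph.Reachable.trans (SimpleGraph.Adj.reachable ?_) r
          exact adj2 t
  obtain ⟨s, hs1, hs2, hs⟩ := hne
  refine isKempeChain_of_reachable ⟨z s, hs⟩ (fun v hv => hv.1) ⟨hs, s, hs1, hs2, rfl⟩ ?_ ?_
  · rintro v ⟨hv, t, ht1, ht2, rfl⟩
    rcases le_total s t with h | h
    · obtain ⟨k, hk⟩ := Int.eq_ofNat_of_zero_le (sub_nonneg.2 h)
      obtain rfl : t = s + k := by omega
      exact key k s hs1 ht2 hs hv
    · obtain ⟨k, hk⟩ := Int.eq_ofNat_of_zero_le (sub_nonneg.2 h)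
      obtain rfl : s = t + k := by omega
      exact (key k t ht1 hs2 hv hs).symm
  · rintro v ⟨hv, t, ht1, ht2, rfl⟩ v' hv' hadj
    exact ⟨hv', hclosed t ht1 ht2 hv v' hv' hadj⟩

/-- The colours of the neighbours of `a`. -/
def rim (z : ℤ → W) (A : H.Coloring (Option (ZMod 3))) (i : ℤ) : ZMod 3 := (A (z (2 * i))).getD 0

/-- The places of the outer vertices that have the colour of `a`. -/
def Marked (z : ℤ → W) (A : H.Coloring (Option (ZMod 3))) (i : ℤ) : Prop :=
  A (z (2 * i + 1)) = none

/-- The places of the rim vertices next to a marked vertex. -/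
def Cut (z : ℤ → W) (A : H.Coloring (Option (ZMod 3))) (i : ℤ) : Prop :=
  Marked z A (i - 1) ∨ Marked z A i

namespace IsStrip
variable (hz : IsStrip H n a z) {A : H.Coloring (Option (ZMod 3))} (hA : A a = none)
include hz

theorem periodic_mul (t k : ℤ) : z (t + 2 * n * k) = z t := by
  induction k using Int.induction_on with
  | zero => simp
  | succ k ih =>
    have h := hz.periodic (t + 2 * n * k)
    rw [ih] at h
    rw [← h]; congr 1; ring
  | pred k ih => rw [← ih, ← hz.periodic (t + 2 * n * (-k - 1))]; congr 1; ring

theorem rim_add_mul (i k : ℤ) : rim z A (i + n * k) = rim z A i := by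
  unfold rim
  rw [← hz.periodic_mul (2 * i) k]
  congr 3; ring

theorem marked_add_mul (i k : ℤ) : Marked z A (i + n * k) ↔ Marked z A i := by
  unfold Marked
  rw [← hz.periodic_mul (2 * i + 1) k]
  have : 2 * (i + n * k) + 1 = 2 * i + 1 + 2 * n * k := by ring
  rw [this]

theorem rim_add (i : ℤ) : rim z A (i + n) = rim z A i := by
  simpa using hz.rim_add_mul (A := A) i 1

theorem marked_add (i : ℤ) : Marked z A (i + n) ↔ Marked z A i := by
  simpa using hz.marked_add_mul (A := A) i 1

theorem cut_add (i : ℤ) : Cut z A (i + n) ↔ Cut z A i := by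
  unfold Cut
  rw [hz.marked_add, ← hz.marked_add (i - 1)]
  ring_nf

include hA

/-- Rim vertices avoid the colour `none` of their neighbour `a`, so the default value in `rim` is
never taken. -/
theorem apply_even (i : ℤ) : A (z (2 * i)) = some (rim z A i) := by
  have h : A (z (2 * i)) ≠ A a := A.valid ((hz.adj _ _).2 (by simp))
  rw [hA] at h
  obtain ⟨x, hx⟩ := Option.ne_none_iff_exists'.1 h
  simp [rim, hx]

theorem rim_ne_succ (i : ℤ) : rim z A i ≠ rim z A (i + 1) := by
  have h : A (z (2 * i)) ≠ A (z (2 * (i + 1))) := A.valid ((hz.adj _ _).2 (by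
    rw [show 2 * (i + 1) = 2 * i + 2 by ring]; simp))
  rw [hz.apply_even hA, hz.apply_even hA] at h
  simpa using h

/-- The three elements of `ZMod 3` sum to 0, so the one that differs from two distinct elements is
minus their sum. -/
theorem apply_odd {i : ℤ} (h : ¬ Marked z A i) :
    A (z (2 * i + 1)) = some (-(rim z A i + rim z A (i + 1))) := by
  obtain ⟨x, hx⟩ := Option.ne_none_iff_exists'.1 h
  have h1 : A (z (2 * i)) ≠ A (z (2 * i + 1)) := A.valid ((hz.adj _ _).2 (by simp))
  have h2 : A (z (2 * (i + 1))) ≠ A (z (2 * i + 1)) := A.valid ((hz.adj _ _).2 (by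
    rw [show 2 * (i + 1) - 1 = 2 * i + 1 by ring]; simp))
  have h3 := hz.rim_ne_succ hA i
  rw [hz.apply_even hA, hx] at h1 h2
  rw [hx]
  simp only [ne_eq, Option.some.injEq] at h1 h2 ⊢
  generalize rim z A i = y at *
  generalize rim z A (i + 1) = y' at *
  clear hx
  revert x y y'
  decide

omit hA in
theorem not_marked_succ {i : ℤ} (h : Marked z A i) : ¬ Marked z A (i + 1) := by
  have h1 : A (z (2 * i + 1)) ≠ A (z (2 * (i + 1) + 1)) := A.valid ((hz.adj _ _).2 (by
    rw [show 2 * (i + 1) + 1 = 2 * i + 1 + 2 by ring]; simp))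
  intro h2
  rw [show A (z (2 * i + 1)) = none from h] at h1
  exact h1 (Eq.symm h2)

omit hA in
theorem not_marked_pred {i : ℤ} (h : Marked z A i) : ¬ Marked z A (i - 1) := fun h' =>
  hz.not_marked_succ h' (by simpa using h)

/-- If the rim colours agreed, both rim edges would miss the same colour, and two adjacent outer
vertices would carry it. -/
theorem rim_ne_of_not_marked {i : ℤ} (h : ¬ Marked z A i) (h' : ¬ Marked z A (i + 1)) :
    rim z A i ≠ rim z A (i + 2) := by
  have h1 : A (z (2 * i + 1)) ≠ A (z (2 * (i + 1) + 1)) := A.valid ((hz.adj _ _).2 (by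
    rw [show 2 * (i + 1) + 1 = 2 * i + 1 + 2 by ring]; simp))
  rw [hz.apply_odd hA h, hz.apply_odd hA h', add_assoc, one_add_one_eq_two] at h1
  intro e
  exact h1 (by rw [← e, add_comm])

theorem rim_ne_of_not_cut {i : ℤ} (h : ¬ Cut z A i) : rim z A (i - 1) ≠ rim z A (i + 1) := by
  simp only [Cut, not_or] at h
  have := hz.rim_ne_of_not_marked hA (i := i - 1) h.1 (by simpa using h.2)
  rwa [show i - 1 + 2 = i + 1 by ring] at this

/-- Reflecting the colours of the rim between two cut vertices of the same colour. -/
theorem exists_flip {j l : ℤ} (hjl : j < l) (hln : l ≤ j + n) (hx : rim z A j = rim z A l)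
    (hj : Cut z A j) (hl : Cut z A l)
    (hbet : ∀ i, j < i → i < l → Cut z A i → rim z A i ≠ rim z A j) :
    ∃ B : H.Coloring (Option (ZMod 3)), KempeChange A B ∧ B a = none ∧
      (∀ i, j ≤ i → i ≤ l → rim z B i = 2 * rim z A j - rim z A i) ∧
      (∀ i, l ≤ i → i ≤ j + n → rim z B i = rim z A i) ∧
      (∀ i, Marked z B i ↔ Marked z A i) := by
  set m := rim z A j with hm
  have hne1 : ∀ m : ZMod 3, (some (m + 1) : Option (ZMod 3)) ≠ some (m - 1) := by decide
  have hbic : ∀ v, v ∈ bicoloured A (some (m + 1)) (some (m - 1)) ↔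
      A v ≠ none ∧ A v ≠ some m := by
    intro v
    simp only [bicoloured, Set.mem_ofPred_eq]
    generalize A v = c
    generalize m = m
    revert m c
    decide
  have hjl1 : j + 1 < l := by
    rcases eq_or_lt_of_le (show j + 1 ≤ l from hjl) with h | h
    · exact absurd hx (h ▸ hz.rim_ne_succ hA j)
    · exact h
  have hodd : ∀ i, rim z A i = m → A (z (2 * i + 1)) ≠ some m := by
    intro i hi
    rw [← hi, ← hz.apply_even hA]
    exact (A.valid ((hz.adj _ _).2 (by simp))).symm
  have hodd' : ∀ i, rim z A i = m → A (z (2 * i - 1)) ≠ some m := by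
    intro i hi
    rw [← hi, ← hz.apply_even hA]
    exact (A.valid ((hz.adj _ _).2 (by simp))).symm
  have hchain : IsKempeChain A (some (m + 1)) (some (m - 1))
      {v | v ∈ bicoloured A (some (m + 1)) (some (m - 1)) ∧
        ∃ t, 2 * j + 1 ≤ t ∧ t ≤ 2 * l - 1 ∧ v = z t} := by
    -- Two consecutive misses would be a rim vertex of colour `m` beside a marked place, that is, a
    -- cut vertex excluded by `hbet`; an outer vertex of colour `m` cannot be adjacent to that rim
    -- vertex.
    have hgap : ∀ t, 2 * j + 1 ≤ t → t < 2 * l - 1 →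
        z t ∈ bicoloured A (some (m + 1)) (some (m - 1)) ∨
        z (t + 1) ∈ bicoloured A (some (m + 1)) (some (m - 1)) := by
      intro t ht1 ht2
      by_contra! hcon
      rw [hbic, hbic] at hcon
      simp only [ne_eq, not_and, not_not] at hcon
      obtain ⟨i, rfl | rfl⟩ := Int.even_or_odd' t
      · have h1 : rim z A i = m := by simpa [hz.apply_even hA] using hcon.1
        have h2 : Marked z A i := by
          by_contra h
          exact hodd i h1 (by simpa using hcon.2 h)
        exact hbet i (by omega) (by omega) (Or.inr h2) h1
      · rw [show 2 * i + 1 + 1 = 2 * (i + 1) by ring] at hcon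
        have h1 : rim z A (i + 1) = m := by simpa [hz.apply_even hA] using hcon.2
        have h2 : Marked z A i := by
          by_contra h
          have := hodd' (i + 1) h1
          rw [show 2 * (i + 1) - 1 = 2 * i + 1 by ring] at this
          exact this (by simpa using hcon.1 h)
        exact hbet (i + 1) (by omega) (by omega) (Or.inl (by simpa using h2)) h1
    apply hz.isKempeChain
    · rcases hgap (2 * j + 1) le_rfl (by omega) with h | h
      · exact ⟨_, by omega, by omega, h⟩
      · exact ⟨_, by omega, by omega, h⟩
    · exact hgap
    · intro t ht1 ht2 ht v hv hadj
      rw [hbic] at ht hv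
      rw [hz.adj] at hadj
      have bad_even : ∀ i, rim z A i = m → v ≠ z (2 * i) := by
        rintro i hi rfl
        exact hv.2 (by rw [hz.apply_even hA, hi])
      -- The only edge that bypasses a rim vertex of colour `m` joins the outer vertices on its two
      -- sides. At a cut vertex one of them is marked, so the chain ends there.
      have bad_odd : ∀ i, Cut z A i → z t = z (2 * i + 1) → v ≠ z (2 * i - 1) := by
        rintro i hi h rfl
        rcases hi with h1 | h1
        · unfold Marked at h1
          rw [show 2 * (i - 1) + 1 = 2 * i - 1 by ring] at h1
          exact hv.1 h1
        · exact ht.1 (h ▸ h1)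
      have bad_odd' : ∀ i, Cut z A i → z t = z (2 * i - 1) → v ≠ z (2 * i + 1) := by
        rintro i hi h rfl
        rcases hi with h1 | h1
        · unfold Marked at h1
          rw [show 2 * (i - 1) + 1 = 2 * i - 1 by ring] at h1
          exact ht.1 (h ▸ h1)
        · exact hv.1 h1
      rcases hadj with ⟨rfl, -⟩ | rfl | rfl | rfl | rfl
      · exact absurd hA hv.1
      · refine ⟨_, ?_, ?_, rfl⟩
        · omega
        · by_contra h
          exact bad_even l hx.symm (by congr 1; omega)
      · refine ⟨_, ?_, ?_, rfl⟩
        · by_contra h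
          exact bad_even j rfl (by congr 1; omega)
        · omega
      · refine ⟨_, ?_, ?_, rfl⟩
        · omega
        · by_contra h
          rcases (show t = 2 * l - 2 ∨ t = 2 * l - 1 by omega) with rfl | rfl
          · exact bad_even l hx.symm (by congr 1; omega)
          · exact bad_odd' l hl rfl (by congr 1; omega)
      · refine ⟨_, ?_, ?_, rfl⟩
        · by_contra h
          rcases (show t = 2 * j + 2 ∨ t = 2 * j + 1 by omega) with rfl | rfl
          · exact bad_even j rfl (by congr 1; omega)
          · exact bad_odd j hj rfl (by congr 1; omega)
        · omega
  obtain ⟨B, hAB, hin, hout⟩ := exists_kempeChange (hne1 m) hchain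
  have hnone : ∀ v, B v = none ↔ A v = none := by
    intro v
    by_cases hv : v ∈ {v | v ∈ bicoloured A (some (m + 1)) (some (m - 1)) ∧
        ∃ t, 2 * j + 1 ≤ t ∧ t ≤ 2 * l - 1 ∧ v = z t}
    · rw [hin v hv, Equiv.swap_apply_eq_iff, Equiv.swap_apply_of_ne_of_ne (by simp) (by simp)]
    · rw [hout v hv]
  have hsw : ∀ m y : ZMod 3, y ≠ m → Equiv.swap (some (m + 1)) (some (m - 1)) (some y) =
    some (2 * m - y) := by decide
  refine ⟨B, hAB, (hnone a).2 hA, ?_, ?_, fun i => hnone _⟩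
  · intro i hi1 hi2
    by_cases h : rim z A i = m
    · have : B (z (2 * i)) = A (z (2 * i)) := by
        apply hout
        rintro ⟨h1, -⟩
        rw [hbic, hz.apply_even hA, h] at h1
        exact h1.2 rfl
      rw [rim, this, hz.apply_even hA, h]
      simp; ring
    · have : B (z (2 * i)) = some (2 * m - rim z A i) := by
        rw [hin, hz.apply_even hA, hsw _ _ h]
        refine ⟨?_, 2 * i, ?_, ?_, rfl⟩
        · rw [hbic, hz.apply_even hA]
          simpa using h
        · have : i ≠ j := by rintro rfl; exact h rfl
          omega
        · have : i ≠ l := by rintro rfl; exact h hx.symm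
          omega
      rw [rim, this]
      simp
  · intro i hi1 hi2
    have : B (z (2 * i)) = A (z (2 * i)) := by
      apply hout
      rintro ⟨-, t, ht1, ht2, ht⟩
      have hd := hz.dvd_of_eq _ _ ht
      obtain ⟨k, hk⟩ := hd
      have hn := hz.five_le
      rcases lt_trichotomy k 0 with h | h | h
      · nlinarith
      · subst h; omega
      · nlinarith
    rw [rim, this, rim]

/-- Exchanging the marked and the unmarked places in a run of places whose outer vertices
avoid the same colour of the rim. -/
theorem exists_toggle {j l : ℤ} (k : ZMod 3) (hjl : j ≤ l)
    (hk : ∀ i, j ≤ i → i ≤ l → -(rim z A i + rim z A (i + 1)) = k)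
    (hj : ¬ Marked z A (j - 1)) (hl : ¬ Marked z A (l + 1))
    (hjk : rim z A (j - 1) ≠ rim z A (j + 1)) (hlk : rim z A l ≠ rim z A (l + 2)) :
    ∃ B : H.Coloring (Option (ZMod 3)), KempeChange A B ∧ B a = none ∧
      (∀ i, rim z B i = rim z A i) ∧ (∀ i, j ≤ i → i ≤ l → (Marked z B i ↔ ¬ Marked z A i)) ∧
      (∀ i, l < i → i < j + n → (Marked z B i ↔ Marked z A i)) := by
  have hbic : ∀ v, v ∈ bicoloured A none (some k) ↔ A v = none ∨ A v = some k := fun v => Iff.rfl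
  have h3 : ∀ y y' : ZMod 3, y ≠ y' → y ≠ -(y + y') ∧ y' ≠ -(y + y') := by decide
  have hk1 : ∀ i, j ≤ i → i ≤ l → rim z A i ≠ k ∧ rim z A (i + 1) ≠ k := by
    intro i h1 h2
    rw [← hk i h1 h2]
    exact h3 _ _ (hz.rim_ne_succ hA i)
  have hin : ∀ i, j ≤ i → i ≤ l → z (2 * i + 1) ∈ bicoloured A none (some k) := by
    intro i h1 h2
    rw [hbic]
    by_cases h : Marked z A i
    · exact Or.inl h
    · rw [hz.apply_odd hA h, hk i h1 h2]
      simp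
  have heven : ∀ i, j ≤ i → i ≤ l + 1 → z (2 * i) ∉ bicoloured A none (some k) := by
    intro i h1 h2
    rw [hbic, hz.apply_even hA]
    simp only [reduceCtorEq, Option.some.injEq, false_or]
    rcases h1.eq_or_lt with rfl | h1
    · exact (hk1 _ le_rfl hjl).1
    · have := (hk1 (i - 1) (by omega) (by omega)).2
      simpa using this
  -- By `hjk` the slope does not change at `j`, so the unmarked outer vertex before the run has a
  -- colour other than `k`. The run ends there, and likewise on the right.
  have hjout : z (2 * j - 1) ∉ bicoloured A none (some k) := by
    have h1 := hz.apply_odd hA hj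
    rw [show 2 * (j - 1) + 1 = 2 * j - 1 by ring] at h1
    rw [hbic, h1]
    simp only [reduceCtorEq, Option.some.injEq, false_or]
    intro h
    apply hjk
    have := hk j le_rfl hjl
    rw [← h, sub_add_cancel] at this
    linear_combination this
  have hlout : z (2 * l + 3) ∉ bicoloured A none (some k) := by
    have h1 := hz.apply_odd hA hl
    rw [show 2 * (l + 1) + 1 = 2 * l + 3 by ring] at h1
    rw [hbic, h1]
    simp only [reduceCtorEq, Option.some.injEq, false_or]
    intro h
    apply hlk
    have := hk l hjl le_rfl
    rw [← h, add_assoc, one_add_one_eq_two] at this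
    linear_combination -this
  have hchain : IsKempeChain A none (some k)
      {v | v ∈ bicoloured A none (some k) ∧
        ∃ t, 2 * j + 1 ≤ t ∧ t ≤ 2 * l + 1 ∧ v = z t} := by
    apply hz.isKempeChain
    · exact ⟨2 * j + 1, le_rfl, by omega, hin j le_rfl hjl⟩
    · intro t ht1 ht2
      obtain ⟨i, rfl | rfl⟩ := Int.even_or_odd' t
      · exact Or.inr (hin i (by omega) (by omega))
      · exact Or.inl (hin i (by omega) (by omega))
    · intro t ht1 ht2 ht v hv hadj
      obtain ⟨i, rfl | rfl⟩ := Int.even_or_odd' t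
      · exact absurd ht (heven i (by omega) (by omega))
      · rw [hz.adj] at hadj
        rcases hadj with ⟨-, h⟩ | rfl | rfl | rfl | rfl
        · exact absurd h (by simp)
        · exact absurd hv (by
            rw [show 2 * i + 1 + 1 = 2 * (i + 1) by ring]
            exact heven (i + 1) (by omega) (by omega))
        · exact absurd hv (by
            rw [show 2 * i + 1 - 1 = 2 * i by ring]
            exact heven i (by omega) (by omega))
        · refine ⟨_, ?_, ?_, rfl⟩
          · omega
          · by_contra h
            apply hlout
            rwa [show 2 * l + 3 = 2 * i + 1 + 2 by omega]
        · refine ⟨_, ?_, ?_, rfl⟩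
          · by_contra h
            apply hjout
            rwa [show 2 * j - 1 = 2 * i + 1 - 2 by omega]
          · omega
  have hn := hz.five_le
  have hevenout : ∀ t, Even t → z t ∉ {v | v ∈ bicoloured A none (some k) ∧
        ∃ t, 2 * j + 1 ≤ t ∧ t ≤ 2 * l + 1 ∧ v = z t} := by
    rintro t ⟨s, rfl⟩ ⟨hb, t', ht1, ht2, ht⟩
    obtain ⟨c, hc⟩ := hz.dvd_of_eq _ _ ht
    obtain ⟨i, rfl | rfl⟩ := Int.even_or_odd' t'
    · exact heven i (by omega) (by omega) (ht ▸ hb)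
    · have : (2 : ℤ) ∣ 2 * n * c := ⟨n * c, by ring⟩
      omega
  obtain ⟨B, hAB, hBin, hBout⟩ := exists_kempeChange (by simp) hchain
  refine ⟨B, hAB, ?_, ?_, ?_, ?_⟩
  · rw [hBout a, hA]
    rintro ⟨-, t, -, -, ht⟩
    exact hz.ne t ht.symm
  · intro i
    rw [rim, rim, hBout _ (hevenout _ (by simp))]
  · intro i hi1 hi2
    unfold Marked
    rw [hBin _ ⟨hin i hi1 hi2, _, by omega, by omega, rfl⟩]
    rcases hin i hi1 hi2 with h | h <;> rw [h] <;> simp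
  · intro i hi1 hi2
    unfold Marked
    rw [hBout]
    rintro ⟨-, t, ht1, ht2, ht⟩
    obtain ⟨c, hc⟩ := hz.dvd_of_eq _ _ ht
    rcases lt_trichotomy c 0 with h | h | h
    · nlinarith
    · subst h; omega
    · nlinarith

end IsStrip
end Strip
end KempeH
-- Counting marks, straightening arcs, removing marks
namespace KempeH

theorem exists_int_next {C : ℤ → Prop} {p q : ℤ} (hpq : p < q) (hq : C q) :
    ∃ r, p < r ∧ r ≤ q ∧ C r ∧ ∀ i, p < i → i < r → ¬ C i := by
  classical
  obtain ⟨r, ⟨h1, h2⟩, h3⟩ := Int.exists_least_of_bdd (P := fun i => p < i ∧ C i)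
    ⟨p, fun i hi => hi.1.le⟩ ⟨q, hpq, hq⟩
  exact ⟨r, h1, h3 q ⟨hpq, hq⟩, h2, fun i hi1 hi2 hC => by have := h3 i ⟨hi1, hC⟩; omega⟩

theorem exists_int_prev {C : ℤ → Prop} {p q : ℤ} (hpq : p < q) (hp : C p) :
    ∃ r, p ≤ r ∧ r < q ∧ C r ∧ ∀ i, r < i → i < q → ¬ C i := by
  classical
  obtain ⟨r, ⟨h1, h2⟩, h3⟩ := Int.exists_greatest_of_bdd (P := fun i => i < q ∧ C i)
    ⟨q, fun i hi => hi.1.le⟩ ⟨p, hpq, hp⟩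
  exact ⟨r, h3 p ⟨hpq, hp⟩, h1, h2, fun i hi1 hi2 hC => by have := h3 i ⟨hi2, hC⟩; omega⟩

section Sweep
variable {W : Type*} {H : SimpleGraph W} {n : ℕ} {a : W} {z : ℤ → W}

open Classical in
/-- The number of cut vertices with index in `[P, Q)`. -/
noncomputable def cutCount (z : ℤ → W) (A : H.Coloring (Option (ZMod 3))) (P Q : ℤ) : ℕ :=
  ((Finset.Ico P Q).filter (Cut z A)).card

open Classical in
/-- The number of marked places in `[P, Q)`. -/
noncomputable def markCount (z : ℤ → W) (A : H.Coloring (Option (ZMod 3))) (P Q : ℤ) : ℕ :=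
  ((Finset.Ico P Q).filter (Marked z A)).card

theorem cut_congr {A B : H.Coloring (Option (ZMod 3))} (h : ∀ i, Marked z B i ↔ Marked z A i)
    (i : ℤ) : Cut z B i ↔ Cut z A i := by
  simp only [Cut, h]

theorem cutCount_congr {A B : H.Coloring (Option (ZMod 3))}
    (h : ∀ i, Marked z B i ↔ Marked z A i) (P Q : ℤ) : cutCount z B P Q = cutCount z A P Q := by
  unfold cutCount
  congr 1
  ext i
  simp [cut_congr h]

theorem cutCount_lt {A : H.Coloring (Option (ZMod 3))} {P Q P' Q' c : ℤ} (hP : P ≤ P')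
    (hQ : Q' ≤ Q) (hc : Cut z A c) (h1 : P ≤ c) (h2 : c < Q) (h3 : c < P' ∨ Q' ≤ c) :
    cutCount z A P' Q' + 1 ≤ cutCount z A P Q := by
  classical
  apply Finset.card_lt_card
  rw [Finset.ssubset_iff_of_subset]
  · exact ⟨c, by simp [hc, h1, h2], by simp only [Finset.mem_filter, Finset.mem_Ico]; omega⟩
  · intro i
    simp only [Finset.mem_filter, Finset.mem_Ico]
    rintro ⟨hi, h⟩
    exact ⟨by omega, h⟩

namespace IsStrip
variable (hz : IsStrip H n a z) {A : H.Coloring (Option (ZMod 3))} (hA : A a = none)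
include hz

/-- At most half of the places are marked. -/
theorem markCount_le (P : ℤ) : markCount z A P (P + n) ≤ n / 2 := by
  classical
  have hn := hz.five_le
  -- The cyclic successor maps the marked places injectively to unmarked ones.
  have h := Finset.card_le_card_of_injOn (fun i : ℤ => if i + 1 = P + n then P else i + 1)
    (s := (Finset.Ico P (P + n)).filter (Marked z A))
    (t := (Finset.Ico P (P + n)).filter (fun i => ¬ Marked z A i)) (by
      intro i hi
      simp only [Finset.coe_filter, Finset.mem_Ico, Set.mem_ofPred_eq] at hi ⊢
      have h1 := hz.not_marked_succ hi.2
      split_ifs with h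
      · rw [h, hz.marked_add] at h1
        exact ⟨by omega, h1⟩
      · exact ⟨by omega, h1⟩) (by
      intro i hi i' hi' e
      simp only [Finset.coe_filter, Finset.mem_Ico, Set.mem_ofPred_eq] at hi hi'
      dsimp only at e
      split_ifs at e <;> omega)
  have h2 := Finset.card_filter_add_card_filter_not (s := Finset.Ico P (P + n)) (Marked z A)
  rw [Int.card_Ico] at h2
  unfold markCount
  omega

/-- Each mark creates two cut vertices, the ends of its rim edge. -/
theorem cutCount_le (P : ℤ) : cutCount z A P (P + n) ≤ 2 * (n / 2) := by
  classical
  have h1 := hz.markCount_le (A := A) P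
  have h2 := hz.markCount_le (A := A) (P - 1)
  have h3 : cutCount z A P (P + n) ≤ markCount z A (P - 1) (P - 1 + n) + markCount z A P (P + n) := by
    unfold cutCount markCount
    have e : (Finset.Ico P (P + n)).filter (Cut z A) ⊆
        ((Finset.Ico (P - 1) (P - 1 + n)).filter (Marked z A)).image (· + 1) ∪
        (Finset.Ico P (P + n)).filter (Marked z A) := by
      intro i hi
      simp only [Finset.mem_filter, Finset.mem_Ico, Finset.mem_union, Finset.mem_image] at hi ⊢
      rcases hi.2 with h | h
      · exact Or.inl ⟨i - 1, ⟨by omega, h⟩, by ring⟩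
      · exact Or.inr ⟨hi.1, h⟩
    have h4 := (Finset.card_le_card e).trans (Finset.card_union_le _ _)
    have h5 := Finset.card_image_le (s := (Finset.Ico (P - 1) (P - 1 + n)).filter (Marked z A))
      (f := (· + 1))
    omega
  omega

theorem cutCount_mono_le {P Q P' : ℤ} (hP : P' ≤ P) (hQ : Q ≤ P' + n) :
    cutCount z A P Q ≤ 2 * (n / 2) := by
  classical
  refine le_trans ?_ (hz.cutCount_le (A := A) P')
  apply Finset.card_le_card
  exact Finset.filter_subset_filter _ (Finset.Ico_subset_Ico hP hQ)

theorem markCount_mono_le {P Q P' : ℤ} (hP : P' ≤ P) (hQ : Q ≤ P' + n) :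
    markCount z A P Q ≤ n / 2 := by
  classical
  refine le_trans ?_ (hz.markCount_le (A := A) P')
  apply Finset.card_le_card
  exact Finset.filter_subset_filter _ (Finset.Ico_subset_Ico hP hQ)

include hA

/-- Between two consecutive cut vertices the colours of the rim form an arithmetic progression. -/
theorem exists_slope {p q : ℤ} (h : ∀ i, p < i → i < q → ¬ Cut z A i) :
    ∃ δ : ZMod 3, δ ≠ 0 ∧ ∀ i, p ≤ i → i ≤ q → rim z A i = rim z A p + δ * ((i - p : ℤ) : ZMod 3) := by
  -- Two consecutive slopes are nonzero and, away from cut vertices, have nonzero sum; in `ZMod 3`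
  -- this makes them equal.
  have key : ∀ i, p ≤ i → i < q → rim z A (i + 1) - rim z A i = rim z A (p + 1) - rim z A p := by
    intro i hi
    induction i, hi using Int.leInduction with
    | base => exact fun _ => rfl
    | succ i hi ih =>
      intro hq
      rw [← ih (by omega)]
      have h1 := hz.rim_ne_of_not_cut hA (h (i + 1) (by omega) hq)
      have h2 := hz.rim_ne_succ hA i
      have h3 := hz.rim_ne_succ hA (i + 1)
      rw [add_sub_cancel_right] at h1
      generalize rim z A (i + 1 + 1) = x at *
      generalize rim z A (i + 1) = y at *
      generalize rim z A i = w at *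
      clear ih h
      revert x y w
      decide
  refine ⟨rim z A (p + 1) - rim z A p, sub_ne_zero.2 (hz.rim_ne_succ hA p).symm, ?_⟩
  intro i hi
  induction i, hi using Int.leInduction with
  | base => simp
  | succ i hi ih =>
    intro hq
    have h1 := key i hi (by omega)
    have h2 := ih (by omega)
    push_cast at h2 ⊢
    linear_combination h1 + h2

/-- By at most one flip the rim gets slope `ε` from `P` up to the next cut vertex, if the colour
of `P` recurs at a cut vertex up to `Q`. -/
theorem exists_left_step {ε δ : ZMod 3} (hδ : δ = ε ∨ δ = -ε) {P P₁ Q : ℤ} (hQn : Q ≤ P + n)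
    (hP : Cut z A P) (hP₁ : ∀ i, P < i → i < P₁ → ¬ Cut z A i)
    (hlin : ∀ i, P ≤ i → i ≤ P₁ → rim z A i = rim z A P + δ * ((i - P : ℤ) : ZMod 3))
    (h : δ = ε ∨ ∃ i, P < i ∧ i ≤ Q ∧ Cut z A i ∧ rim z A i = rim z A P) :
    ∃ B, KempeWithin 1 A B ∧ B a = none ∧
      (∀ i, P ≤ i → i ≤ P₁ → rim z B i = rim z A P + ε * ((i - P : ℤ) : ZMod 3)) ∧
      (∀ i, Q ≤ i → i ≤ P + n → rim z B i = rim z A i) ∧ ∀ i, Marked z B i ↔ Marked z A i := by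
  by_cases he : δ = ε
  · exact ⟨A, (KempeWithin.refl A).mono (by simp), hA, he ▸ hlin, fun _ _ _ => rfl, fun _ => Iff.rfl⟩
  have h := h.resolve_left he
  have hδ := hδ.resolve_left he
  obtain ⟨i, hi1, hi2, hi3⟩ := h
  obtain ⟨P', h1, h2, h3, h4⟩ := exists_int_next (C := fun i => Cut z A i ∧ rim z A i = rim z A P)
    hi1 hi3
  obtain ⟨B, hAB, hB, hB1, hB2, hB3⟩ := hz.exists_flip hA h1 (by omega) h3.2.symm hP h3.1
    (fun i hi hi' hc e => h4 i hi hi' ⟨hc, e⟩)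
  -- The flip reaches at least to `P₁`, so it negates the whole first segment.
  have hle : P₁ ≤ P' := by
    by_contra hlt
    exact hP₁ P' h1 (by omega) h3.1
  refine ⟨B, hAB.within, hB, ?_, fun i h5 h6 => hB2 i (by omega) h6, hB3⟩
  intro i h5 h6
  rw [hB1 i h5 (by omega), hlin i h5 h6, hδ]
  ring

/-- The mirror image of `exists_left_step`: the flip goes from `Q` back to the previous cut vertex
of its colour. -/
theorem exists_right_step {ε δ : ZMod 3} (hδ : δ = ε ∨ δ = -ε) {P Q₁ Q : ℤ} (hQn : Q ≤ P + n)
    (hQ : Cut z A Q) (hQ₁Q : Q₁ < Q) (hQ₁ : ∀ i, Q₁ < i → i < Q → ¬ Cut z A i)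
    (hlin : ∀ i, Q₁ ≤ i → i ≤ Q → rim z A i = rim z A Q₁ + δ * ((i - Q₁ : ℤ) : ZMod 3))
    (h : δ = ε ∨ ∃ i, P ≤ i ∧ i < Q ∧ Cut z A i ∧ rim z A i = rim z A Q) :
    ∃ B, KempeWithin 1 A B ∧ B a = none ∧
      (∀ i, Q₁ ≤ i → i ≤ Q → rim z B i = rim z A Q - ε * ((Q - i : ℤ) : ZMod 3)) ∧
      (∀ i, Q ≤ i → i ≤ P + n → rim z B i = rim z A i) ∧ ∀ i, Marked z B i ↔ Marked z A i := by
  have hlin' : ∀ i, Q₁ ≤ i → i ≤ Q → rim z A i = rim z A Q - δ * ((Q - i : ℤ) : ZMod 3) := by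
    intro i h1 h2
    rw [hlin i h1 h2, hlin Q hQ₁Q.le le_rfl]
    push_cast
    ring
  by_cases he : δ = ε
  · exact ⟨A, (KempeWithin.refl A).mono (by simp), hA, he ▸ hlin', fun _ _ _ => rfl, fun _ => Iff.rfl⟩
  have h := h.resolve_left he
  have hδ := hδ.resolve_left he
  obtain ⟨i, hi1, hi2, hi3⟩ := h
  obtain ⟨Q', h1, h2, h3, h4⟩ := exists_int_prev (C := fun i => Cut z A i ∧ rim z A i = rim z A Q)
    hi2 hi3
  obtain ⟨B, hAB, hB, hB1, hB2, hB3⟩ := hz.exists_flip hA h2 (by omega) h3.2 h3.1 hQ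
    (fun i hi hi' hc e => h4 i hi hi' ⟨hc, e.trans h3.2⟩)
  have hle : Q' ≤ Q₁ := by
    by_contra hlt
    exact hQ₁ Q' (by omega) h2 h3.1
  refine ⟨B, hAB.within, hB, ?_, fun i h5 h6 => hB2 i (by omega) (by omega), hB3⟩
  intro i h5 h6
  rw [hB1 i (by omega) h6, hlin' i h5 h6, hδ, h3.2]
  ring

/-- One of the two ends can always be extended. -/
theorem not_both_stuck {ε : ZMod 3} {P P₁ Q₁ Q : ℤ} (hP₁ : P < P₁)
    (hP₁Q : P₁ ≤ Q) (hQ₁ : P ≤ Q₁) (hQ₁Q : Q₁ < Q) (hQ : Cut z A Q)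
    (hcP₁ : Cut z A P₁) (hcQ₁ : Cut z A Q₁)
    (hPP₁ : ∀ i, P < i → i < P₁ → ¬ Cut z A i)
    (hlin₁ : rim z A P₁ = rim z A P + -ε * ((P₁ - P : ℤ) : ZMod 3))
    (hlin₂ : rim z A Q = rim z A Q₁ + -ε * ((Q - Q₁ : ℤ) : ZMod 3))
    (hPQ : rim z A Q - rim z A P = ε * ((Q - P : ℤ) : ZMod 3))
    (hstuckP : ∀ i, P < i → i ≤ Q → Cut z A i → rim z A i ≠ rim z A P)
    (hstuckQ : ∀ i, P ≤ i → i < Q → Cut z A i → rim z A i ≠ rim z A Q) : False := by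
  have hne := hstuckP Q (by omega) le_rfl hQ
  push_cast at hlin₁ hlin₂ hPQ
  -- If the arc is a single segment, its colour difference is both `ε` and `-ε` times its length,
  -- hence 0, so the colour of `P` recurs at `Q`.
  rcases hP₁Q.eq_or_lt with rfl | hlt
  · have : rim z A P₁ - rim z A P = 0 := by
      have h3 : (3 : ZMod 3) = 0 := by decide
      linear_combination 2 * hPQ + 2 * hlin₁ - (rim z A P₁ - rim z A P) * h3
    exact hne (sub_eq_zero.1 this)
  have hP₁Q₁ : P₁ ≤ Q₁ := by
    by_contra h
    rcases hQ₁.eq_or_lt with rfl | h'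
    · have : rim z A Q - rim z A P = 0 := by
        have h3 : (3 : ZMod 3) = 0 := by decide
        linear_combination 2 * hPQ + 2 * hlin₂ - (rim z A Q - rim z A P) * h3
      exact hne (sub_eq_zero.1 this)
    · exact hPP₁ Q₁ h' (by omega) hcQ₁
  -- Being stuck at both ends leaves only the third colour for the inner cut vertices.
  have hint : ∀ i, P < i → i < Q → Cut z A i → rim z A i = rim z A P₁ := by
    intro i h1 h2 hi
    have third : ∀ p q x y : ZMod 3, q ≠ p → x ≠ p → x ≠ q → y ≠ p → y ≠ q → y = x := by decide
    exact third _ _ _ _ hne (hstuckP P₁ hP₁ hP₁Q hcP₁) (hstuckQ P₁ hP₁.le hlt hcP₁)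
      (hstuckP i h1 h2.le hi) (hstuckQ i h1.le h2 hi)
  have hr1 := hstuckP P₁ hP₁ hP₁Q hcP₁
  have hr2 := hstuckQ P₁ hP₁.le hlt hcP₁
  have hQ₁r := hint Q₁ (by omega) hQ₁Q hcQ₁
  -- The middle part from `P₁` to `Q₁` has a length not divisible by 3: the two end segments have
  -- slope `-ε` while the whole arc has mean slope `ε`, and the end colours differ.
  have hdist : ∀ p q r : ZMod 3, q ≠ p → r ≠ p → r ≠ q → (q - p) + (q - r) + (r - p) ≠ 0 := by
    decide
  have hd := hdist _ _ _ hne hr1 hr2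
  have hlen : ε * ((Q₁ : ZMod 3) - P₁) ≠ 0 := by
    convert hd using 1
    linear_combination -hPQ - hlin₁ - hlin₂ - hQ₁r
  -- A mark would make two adjacent rim vertices cut, hence of equal colour. So the middle part is
  -- uniform with equal end colours, and its length is divisible by 3, a contradiction.
  have hnomark : ∀ i, P₁ ≤ i → i < Q₁ → ¬ Marked z A i := by
    intro i h1 h2 hm
    have e1 := hint i (by omega) (by omega) (Or.inr hm)
    have e2 := hint (i + 1) (by omega) (by omega) (Or.inl (by simpa using hm))
    exact hz.rim_ne_succ hA i (e1.trans e2.symm)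
  obtain ⟨δ, hδ, hlin⟩ := hz.exists_slope hA (p := P₁) (q := Q₁) (by
    rintro i h1 h2 (h | h)
    · exact hnomark (i - 1) (by omega) (by omega) h
    · exact hnomark i (by omega) (by omega) h)
  have h1 := hlin Q₁ hP₁Q₁ le_rfl
  rw [hQ₁r] at h1
  have h2 : δ * ((Q₁ - P₁ : ℤ) : ZMod 3) = 0 := by linear_combination -h1
  have h3 := (mul_eq_zero.1 h2).resolve_left hδ
  push_cast at h3
  exact hlen (by rw [h3, mul_zero])

omit hA in
/-- Flips make an arc between cut vertices uniform, if its end colours allow it. -/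
theorem exists_sweep {ε : ZMod 3} (hε : ε ≠ 0) (N : ℕ) : ∀ {A : H.Coloring (Option (ZMod 3))},
    A a = none → ∀ {P Q : ℤ}, P ≤ Q → Q ≤ P + n → Q ≤ P + N → Cut z A P → Cut z A Q →
    rim z A Q - rim z A P = ε * ((Q - P : ℤ) : ZMod 3) →
    ∃ B, KempeWithin (cutCount z A P Q) A B ∧ B a = none ∧
      (∀ i, P ≤ i → i ≤ Q → rim z B i = rim z A P + ε * ((i - P : ℤ) : ZMod 3)) ∧
      (∀ i, Q ≤ i → i ≤ P + n → rim z B i = rim z A i) ∧ ∀ i, Marked z B i ↔ Marked z A i := by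
  induction N with
  | zero =>
    intro A hA P Q h1 h2 h3 hP hQ hPQ
    obtain rfl : Q = P := by push_cast at h3; omega
    refine ⟨A, (KempeWithin.refl A).mono (by simp), hA, ?_, fun _ _ _ => rfl, fun _ => Iff.rfl⟩
    intro i h4 h5
    obtain rfl : i = Q := by omega
    simp
  | succ N ih =>
    intro A hA P Q h1 h2 h3 hP hQ hPQ
    rcases h1.eq_or_lt with rfl | hlt
    · exact ih hA h1 h2 (by omega) hP hQ hPQ
    obtain ⟨P₁, hP1, hP2, hP3, hP4⟩ := exists_int_next hlt hQ
    obtain ⟨Q₁, hQ1, hQ2, hQ3, hQ4⟩ := exists_int_prev hlt hP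
    obtain ⟨δ, hδ0, hδ⟩ := hz.exists_slope hA hP4
    obtain ⟨δ', hδ0', hδ'⟩ := hz.exists_slope hA hQ4
    have hsgn : ∀ ε δ : ZMod 3, ε ≠ 0 → δ ≠ 0 → δ = ε ∨ δ = -ε := by decide
    by_cases hl : δ = ε ∨ ∃ i, P < i ∧ i ≤ Q ∧ Cut z A i ∧ rim z A i = rim z A P
    · obtain ⟨B, hAB, hB, hB1, hB2, hB3⟩ :=
        hz.exists_left_step hA (hsgn ε δ hε hδ0) h2 hP hP4 hδ hl
      have hcut := cut_congr hB3
      have e1 := hB1 P₁ hP1.le le_rfl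
      have e2 := hB2 Q le_rfl h2
      obtain ⟨C, hBC, hC, hC1, hC2, hC3⟩ := ih hB (P := P₁) (Q := Q) hP2 (by omega)
        (by push_cast at h3; omega) ((hcut _).2 hP3) ((hcut _).2 hQ) (by
          rw [e1, e2]
          push_cast at hPQ ⊢
          linear_combination hPQ)
      refine ⟨C, (hAB.trans hBC).mono ?_, hC, ?_, ?_, fun i => (hC3 i).trans (hB3 i)⟩
      · rw [cutCount_congr hB3, add_comm]
        exact cutCount_lt hP1.le le_rfl hP le_rfl hlt (Or.inl hP1)
      · intro i h4 h5
        rcases le_total i P₁ with h6 | h6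
        -- The sweep of the remaining arc fixes the complementary arc, which contains the
        -- straightened segment one period later.
        · rw [← hz.rim_add, hC2 (i + n) (by omega) (by omega), hz.rim_add, hB1 i h4 h6]
        · rw [hC1 i h6 h5, e1]
          push_cast
          ring
      · intro i h4 h5
        rw [hC2 i h4 (by omega), hB2 i h4 h5]
    by_cases hr : δ' = ε ∨ ∃ i, P ≤ i ∧ i < Q ∧ Cut z A i ∧ rim z A i = rim z A Q
    · obtain ⟨B, hAB, hB, hB1, hB2, hB3⟩ :=
        hz.exists_right_step hA (hsgn ε δ' hε hδ0') h2 hQ hQ2 hQ4 hδ' hr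
      have hcut := cut_congr hB3
      have e1 := hB1 Q₁ le_rfl hQ2.le
      have e2 : rim z B P = rim z A P := by
        rw [← hz.rim_add, hB2 (P + n) h2 le_rfl, hz.rim_add]
      obtain ⟨C, hBC, hC, hC1, hC2, hC3⟩ := ih hB (P := P) (Q := Q₁) hQ1 (by omega)
        (by push_cast at h3; omega) ((hcut _).2 hP) ((hcut _).2 hQ3) (by
          rw [e1, e2]
          push_cast at hPQ ⊢
          linear_combination hPQ)
      refine ⟨C, (hAB.trans hBC).mono ?_, hC, ?_, ?_, fun i => (hC3 i).trans (hB3 i)⟩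
      · rw [cutCount_congr hB3, add_comm]
        -- The count is over a half-open interval, so `Q₁`, not `Q`, is the cut vertex that pays for
        -- this flip; on the left it is `P`.
        exact cutCount_lt le_rfl hQ2.le hQ3 hQ1 hQ2 (Or.inr le_rfl)
      · intro i h4 h5
        rcases le_total i Q₁ with h6 | h6
        · rw [hC1 i h4 h6, e2]
        · rw [hC2 i h6 (by omega), hB1 i h6 h5]
          push_cast at hPQ ⊢
          linear_combination hPQ
      · intro i h4 h5
        rw [hC2 i (by omega) (by omega), hB2 i h4 h5]
    rw [not_or, not_exists] at hl hr
    have d1 := (hsgn ε δ hε hδ0).resolve_left hl.1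
    have d2 := (hsgn ε δ' hε hδ0').resolve_left hr.1
    exact (hz.not_both_stuck hA hP1 hP2 hQ1 hQ2 hQ hP3 hQ3 hP4
      (d1 ▸ hδ P₁ hP1.le le_rfl) (d2 ▸ hδ' Q hQ2.le le_rfl) hPQ
      (fun i h1 h2 h3 h4 => hl.2 i ⟨h1, h2, h3, h4⟩)
      (fun i h1 h2 h3 h4 => hr.2 i ⟨h1, h2, h3, h4⟩)).elim

/-- Unmarking or marking a single place. -/
theorem exists_toggle_one {i : ℤ} (h1 : ¬ Marked z A (i - 1)) (h2 : ¬ Marked z A (i + 1))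
    (h3 : rim z A (i - 1) ≠ rim z A (i + 1)) (h4 : rim z A i ≠ rim z A (i + 2)) :
    ∃ B : H.Coloring (Option (ZMod 3)), KempeChange A B ∧ B a = none ∧
      (∀ k, rim z B k = rim z A k) ∧ (Marked z B i ↔ ¬ Marked z A i) ∧
      (∀ k, i < k → k < i + n → (Marked z B k ↔ Marked z A k)) := by
  obtain ⟨B, hAB, hB, hB1, hB2, hB3⟩ := hz.exists_toggle hA (j := i) (l := i) _ le_rfl (by
    intro k hk1 hk2
    obtain rfl : k = i := by omega
    rfl) h1 h2 h3 h4
  exact ⟨B, hAB, hB, hB1, hB2 i le_rfl le_rfl, hB3⟩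

omit hA in
/-- The marks in a uniform arc can be removed. -/
theorem exists_clear (m : ℕ) : ∀ {A : H.Coloring (Option (ZMod 3))}, A a = none → ∀ {P Q : ℤ},
    Q ≤ P + n → markCount z A P Q ≤ m →
    (∀ i, P ≤ i → i < Q → rim z A (i - 1) ≠ rim z A (i + 1) ∧ rim z A i ≠ rim z A (i + 2)) →
    ∃ B, KempeWithin m A B ∧ B a = none ∧ (∀ i, rim z B i = rim z A i) ∧
      (∀ i, P ≤ i → i < Q → ¬ Marked z B i) ∧
      (∀ i, Q ≤ i → i < P + n → (Marked z B i ↔ Marked z A i)) := by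
  classical
  induction m with
  | zero =>
    intro A hA P Q hQ hm hlin
    refine ⟨A, KempeWithin.refl A, hA, fun _ => rfl, ?_, fun _ _ _ => Iff.rfl⟩
    intro i h1 h2 h3
    have : i ∈ (Finset.Ico P Q).filter (Marked z A) := by simp [h1, h2, h3]
    have := Finset.card_pos.2 ⟨i, this⟩
    unfold markCount at hm
    convert Nat.not_lt.2 hm this
  | succ m ih =>
    intro A hA P Q hQ hm hlin
    by_cases h : ∃ i, P ≤ i ∧ i < Q ∧ Marked z A i
    · obtain ⟨i, hi1, hi2, hi3⟩ := h
      -- Both neighbours of a marked place are unmarked, and the toggle leaves the rim alone, so the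
      -- next mark can be treated in the same way.
      obtain ⟨B, hAB, hB, hB1, hB2, hB3⟩ := hz.exists_toggle_one hA (hz.not_marked_pred hi3)
        (hz.not_marked_succ hi3) (hlin i hi1 hi2).1 (hlin i hi1 hi2).2
      have hother : ∀ k, P ≤ k → k < P + n → k ≠ i → (Marked z B k ↔ Marked z A k) := by
        intro k h1 h2 h3
        rcases lt_or_gt_of_ne h3 with h | h
        · rw [← hz.marked_add, hB3 (k + n) (by omega) (by omega), hz.marked_add]
        · exact hB3 k h (by omega)
      obtain ⟨C, hBC, hC, hC1, hC2, hC3⟩ := ih hB (P := P) (Q := Q) hQ (by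
        have : markCount z B P Q < markCount z A P Q := by
          apply Finset.card_lt_card
          rw [Finset.ssubset_iff_of_subset]
          · exact ⟨i, by simp [hi1, hi2, hi3], by simp [hB2, hi3]⟩
          · intro k
            simp only [Finset.mem_filter, Finset.mem_Ico]
            rintro ⟨hk, hkm⟩
            by_cases hki : k = i
            · subst hki
              exact absurd hi3 (hB2.1 hkm)
            · exact ⟨hk, (hother k hk.1 (by omega) hki).1 hkm⟩
        omega) (by simpa only [hB1] using hlin)
      refine ⟨C, (hAB.within.trans hBC).mono (by omega), hC,
        fun k => (hC1 k).trans (hB1 k), hC2, ?_⟩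
      intro k h1 h2
      rw [hC3 k h1 h2, hother k (by omega) h2 (by omega)]
    · refine ⟨A, (KempeWithin.refl A).mono (by simp), hA, fun _ => rfl, ?_, fun _ _ _ => Iff.rfl⟩
      intro i h1 h2 h3
      exact h ⟨i, h1, h2, h3⟩

end IsStrip
end Sweep
end KempeH
-- Normal forms, rotation, and the cases n ≡ 0 and n ≡ 2 modulo 3
namespace KempeH

section Canonical
variable {W : Type*} {H : SimpleGraph W} {n : ℕ} {a : W} {z : ℤ → W}

/-- The colours of the rim go up by `ε` at every edge, except that they go down on `D`. -/
def HasSlope (z : ℤ → W) (A : H.Coloring (Option (ZMod 3))) (ε : ZMod 3) (D : ℤ → Prop) : Prop :=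
  ∀ i, (D i → rim z A (i + 1) = rim z A i - ε) ∧ (¬ D i → rim z A (i + 1) = rim z A i + ε)

/-- The colouring with the slopes given by `D` and the marks given by `T`. -/
def HasPattern (a : W) (z : ℤ → W) (D T : ℤ → Prop) (A : H.Coloring (Option (ZMod 3))) : Prop :=
  A a = none ∧ (∃ ε : ZMod 3, ε ≠ 0 ∧ HasSlope z A ε D) ∧ ∀ i, Marked z A i ↔ T i

theorem HasSlope.congr {A : H.Coloring (Option (ZMod 3))} {ε : ZMod 3} {D D' : ℤ → Prop}
    (h : HasSlope z A ε D) (hD : ∀ i, D i ↔ D' i) : HasSlope z A ε D' := by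
  intro i
  rw [← hD]
  exact h i

theorem HasPattern.congr {A : H.Coloring (Option (ZMod 3))} {D D' T T' : ℤ → Prop}
    (h : HasPattern a z D T A) (hD : ∀ i, D i ↔ D' i) (hT : ∀ i, T i ↔ T' i) :
    HasPattern a z D' T' A := by
  obtain ⟨h1, ⟨ε, hε, h2⟩, h3⟩ := h
  exact ⟨h1, ⟨ε, hε, h2.congr hD⟩, fun i => (h3 i).trans (hT i)⟩

/-- Patterns on the cycle are periodic predicates on the integers; less than a period from `c`,
divisibility reduces to an equality. -/
theorem natCast_dvd_sub_iff {n : ℕ} {i c : ℤ} (h1 : c - n < i) (h2 : i < c + n) :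
    (n : ℤ) ∣ i - c ↔ i = c := by
  constructor
  · intro h
    have := Int.eq_zero_of_abs_lt_dvd h (abs_lt.2 ⟨by omega, by omega⟩)
    omega
  · rintro rfl
    simp

theorem natCast_dvd_add_mul_sub_iff {n : ℕ} (i k c : ℤ) :
    (n : ℤ) ∣ i + n * k - c ↔ (n : ℤ) ∣ i - c := by
  rw [show i + n * k - c = i - c + n * k by ring]
  exact dvd_add_left (dvd_mul_right _ _)

namespace IsStrip
variable (hz : IsStrip H n a z)
include hz

theorem exists_mem_window (P i : ℤ) : ∃ i₀ k : ℤ, i = i₀ + n * k ∧ P ≤ i₀ ∧ i₀ < P + n := by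
  have hn := hz.five_le
  refine ⟨P + (i - P) % n, (i - P) / n, ?_, ?_, ?_⟩
  · have := Int.emod_add_mul_ediv (i - P) n
    linarith
  · have := Int.emod_nonneg (i - P) (b := n) (by omega)
    omega
  · have := Int.emod_lt_of_pos (i - P) (b := n) (by omega)
    omega

theorem hasSlope_of_window {A : H.Coloring (Option (ZMod 3))} {ε : ZMod 3} {D : ℤ → Prop} (P : ℤ)
    (hD : ∀ i k : ℤ, D (i + n * k) ↔ D i)
    (h : ∀ i, P ≤ i → i < P + n → (D i → rim z A (i + 1) = rim z A i - ε) ∧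
      (¬ D i → rim z A (i + 1) = rim z A i + ε)) : HasSlope z A ε D := by
  intro i
  obtain ⟨i₀, k, rfl, h1, h2⟩ := hz.exists_mem_window P i
  rw [hD, add_right_comm, hz.rim_add_mul, hz.rim_add_mul]
  exact h i₀ h1 h2

theorem marked_of_window {A : H.Coloring (Option (ZMod 3))} {T : ℤ → Prop} (P : ℤ)
    (hT : ∀ i k : ℤ, T (i + n * k) ↔ T i)
    (h : ∀ i, P ≤ i → i < P + n → (Marked z A i ↔ T i)) (i : ℤ) : Marked z A i ↔ T i := by
  obtain ⟨i₀, k, rfl, h1, h2⟩ := hz.exists_mem_window P i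
  rw [hT, hz.marked_add_mul]
  exact h i₀ h1 h2

/-- The pattern determines the colouring up to a permutation of the colours. -/
theorem equalUpToPerm {A B : H.Coloring (Option (ZMod 3))} {D T : ℤ → Prop}
    (hA : HasPattern a z D T A) (hB : HasPattern a z D T B) : EqualUpToPerm A B := by
  obtain ⟨hA, ⟨ε, hε, hsA⟩, hmA⟩ := hA
  obtain ⟨hB, ⟨ε', hε', hsB⟩, hmB⟩ := hB
  have hsq : ∀ x : ZMod 3, x ≠ 0 → x * x = 1 := by decide
  have h3 : (3 : ZMod 3) = 0 := by decide
  -- Both slopes are 1 or -1, so their product is the sign that turns `ε'` into `ε`; the two rims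
  -- then differ by an affine map of `ZMod 3`.
  obtain ⟨α, hα⟩ : ∃ α, α = ε * ε' := ⟨_, rfl⟩
  have hα1 : α * α = 1 := by
    rw [hα, mul_mul_mul_comm, hsq _ hε, hsq _ hε', one_mul]
  have hα2 : α * ε' = ε := by rw [hα, mul_assoc, hsq _ hε', mul_one]
  obtain ⟨β, hβ⟩ : ∃ β, β = rim z A 0 - α * rim z B 0 := ⟨_, rfl⟩
  have hstep : ∀ i, rim z A (i + 1) - rim z A i = α * (rim z B (i + 1) - rim z B i) := by
    intro i
    by_cases h : D i
    · rw [(hsA i).1 h, (hsB i).1 h]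
      linear_combination hα2
    · rw [(hsA i).2 h, (hsB i).2 h]
      linear_combination -hα2
  have hrim : ∀ i, rim z A i = α * rim z B i + β := by
    intro i
    induction i using Int.induction_on with
    | zero => rw [hβ]; ring
    | succ i ih =>
      have := hstep i
      linear_combination this + ih
    | pred i ih =>
      have := hstep (-i - 1)
      rw [sub_add_cancel] at this
      linear_combination ih - this
  let e : ZMod 3 ≃ ZMod 3 :=
    { toFun := fun y => α * y + β
      invFun := fun y => α * (y - β)
      left_inv := fun y => by linear_combination y * hα1
      right_inv := fun y => by linear_combination (y - β) * hα1 }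
  refine ⟨Equiv.optionCongr e, fun v => ?_⟩
  rcases hz.surj v with rfl | ⟨t, rfl⟩
  · rw [hA, hB]
    rfl
  · obtain ⟨i, rfl | rfl⟩ := Int.even_or_odd' t
    · rw [hz.apply_even hA, hz.apply_even hB, hrim]
      rfl
    · by_cases h : T i
      · have h1 : A (z (2 * i + 1)) = none := (hmA i).2 h
        have h2 : B (z (2 * i + 1)) = none := (hmB i).2 h
        rw [h1, h2]
        rfl
      · rw [hz.apply_odd hA (mt (hmA i).1 h), hz.apply_odd hB (mt (hmB i).1 h), hrim, hrim]
        change _ = some (α * _ + β)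
        congr 1
        -- An affine map respects third colours because 3β = 0.
        linear_combination -β * h3

/-- Combining a reduction to a family of patterns with rotations of the patterns. -/
theorem kempeEquivalentWithin_of_rotation {F : ℤ → H.Coloring (Option (ZMod 3)) → Prop} {r m : ℕ}
    (hper : ∀ c k A, F (c + n * k) A ↔ F c A)
    (huniq : ∀ c A B, F c A → F c B → EqualUpToPerm A B)
    (hshift : ∀ c A, F c A → ∃ B, KempeWithin r A B ∧ F (c + 1) B)
    (hred : ∀ A : H.Coloring (Option (ZMod 3)), A a = none → ∃ B c, KempeWithin m A B ∧ F c B)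
    {A B : H.Coloring (Option (ZMod 3))} (hA : A a = none) (hB : B a = none) :
    KempeEquivalentWithin (2 * m + r * (n / 2)) A B := by
  have hiter : ∀ (d : ℕ) c A, F c A → ∃ B, KempeWithin (r * d) A B ∧ F (c + d) B := by
    intro d
    induction d with
    | zero => exact fun c A h => ⟨A, KempeWithin.refl A, by simpa using h⟩
    | succ d ih =>
      intro c A h
      obtain ⟨B, h1, h2⟩ := ih c A h
      obtain ⟨C, h3, h4⟩ := hshift _ _ h2
      exact ⟨C, h1.trans h3, by push_cast; rwa [← add_assoc]⟩
  obtain ⟨A', c, hA1, hA2⟩ := hred A hA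
  obtain ⟨B', c', hB1, hB2⟩ := hred B hB
  obtain ⟨c₁, k, rfl, h1, h2⟩ := hz.exists_mem_window c c'
  rw [hper] at hB2
  obtain ⟨d, hd⟩ := Int.eq_ofNat_of_zero_le (sub_nonneg.2 h1)
  obtain rfl : c₁ = c + d := by omega
  -- Rotate whichever colouring has the shorter way to go.
  rcases le_or_gt d (n / 2) with hle | hlt
  · obtain ⟨A'', h3, h4⟩ := hiter d c A' hA2
    refine (kempeEquivalentWithin_of_meet (hA1.trans h3) hB1 (huniq _ _ _ h4 hB2)).mono ?_
    have := Nat.mul_le_mul_left r hle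
    omega
  · obtain ⟨B'', h3, h4⟩ := hiter (n - d) _ B' hB2
    rw [show c + d + ((n - d : ℕ) : ℤ) = c + n * 1 by omega, hper] at h4
    refine (kempeEquivalentWithin_of_meet hA1 (hB1.trans h3) (huniq _ _ _ hA2 h4)).mono ?_
    have := Nat.mul_le_mul_left r (show n - d ≤ n / 2 by omega)
    omega

variable {A : H.Coloring (Option (ZMod 3))} (hA : A a = none)
include hA

theorem exists_hasSlope_of_not_marked (h : ∀ i, ¬ Marked z A i) :
    ∃ ε : ZMod 3, ε ≠ 0 ∧ HasSlope z A ε (fun _ => False) := by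
  obtain ⟨δ, hδ, hlin⟩ := hz.exists_slope hA (p := 0) (q := n)
    (fun i _ _ hc => hc.elim (h _) (h _))
  refine ⟨δ, hδ, hz.hasSlope_of_window 0 (by simp) ?_⟩
  intro i h1 h2
  refine ⟨False.elim, fun _ => ?_⟩
  rw [hlin (i + 1) (by omega) (by omega), hlin i h1 (by omega)]
  push_cast
  ring

/-- Without marks the slope is constant, and going once round the rim changes the colour by a
nonzero multiple of `n`. -/
theorem exists_marked (hn : (n : ZMod 3) ≠ 0) : ∃ i, Marked z A i := by
  by_contra! h
  obtain ⟨δ, hδ, hlin⟩ := hz.exists_slope hA (p := 0) (q := n)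
    (fun i _ _ hc => hc.elim (h _) (h _))
  have h1 := hlin n (by omega) le_rfl
  have h2 := hz.rim_add (A := A) 0
  rw [zero_add] at h2
  rw [h2, left_eq_add, mul_eq_zero] at h1
  push_cast at h1
  simp [hδ, hn] at h1

/-- When 3 divides `n`, the whole rim, cut open at one cut vertex, is an admissible arc for the
sweep: at most 2⌊n/2⌋ flips, then at most ⌊n/2⌋ removals of marks. -/
theorem exists_pattern_zero (hn : (n : ZMod 3) = 0) :
    ∃ B, KempeWithin (3 * (n / 2)) A B ∧
      HasPattern a z (fun _ => False) (fun _ => False) B := by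
  by_cases h : ∃ i, Marked z A i
  · obtain ⟨P, hP⟩ := h
    obtain ⟨B, hAB, hB, hB1, -, hB3⟩ := hz.exists_sweep (ε := 1) (by decide) n hA (P := P)
      (Q := P + n) (by omega) le_rfl le_rfl (Or.inr hP) ((hz.cut_add P).2 (Or.inr hP)) (by
        rw [hz.rim_add]
        push_cast
        simp [hn])
    have hs : HasSlope z B 1 (fun _ => False) := by
      refine hz.hasSlope_of_window P (by simp) fun i h1 h2 => ⟨False.elim, fun _ => ?_⟩
      rw [hB1 _ (by omega) (by omega), hB1 i h1 (by omega)]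
      push_cast
      ring
    have hne : ∀ i, rim z B i ≠ rim z B (i + 2) := by
      intro i
      rw [← one_add_one_eq_two, ← add_assoc, (hs _).2 id, (hs _).2 id]
      generalize rim z B i = x
      revert x
      decide
    obtain ⟨C, hBC, hC, hC1, hC2, -⟩ := hz.exists_clear (n / 2) hB (P := P) (Q := P + n) le_rfl
      (hz.markCount_le P) (fun i _ _ => ⟨by
        have := hne (i - 1)
        rwa [show i - 1 + 2 = i + 1 by ring] at this, hne i⟩)
    refine ⟨C, (hAB.trans hBC).mono ?_, hC, ⟨1, by decide, ?_⟩, ?_⟩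
    · have := hz.cutCount_le (A := A) P
      omega
    · intro i
      rw [hC1, hC1]
      exact hs i
    · exact hz.marked_of_window P (by simp) (fun i h1 h2 => by simpa using hC2 i h1 h2)
  · exact ⟨A, (KempeWithin.refl A).mono (by simp), hA,
      hz.exists_hasSlope_of_not_marked hA (not_exists.1 h), by simpa using h⟩

/-- One edge of slope `-ε` and n - 1 of slope `ε` add up to (n - 2)ε = 0. The exceptional edge is
that of some mark `c`; both its ends are cut vertices, so the rest of the rim can be swept. -/
theorem exists_pattern_two (hn : (n : ZMod 3) = 2) :
    ∃ B c, KempeWithin (3 * (n / 2)) A B ∧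
      HasPattern a z (fun i => (n : ℤ) ∣ i - c) (fun i => (n : ℤ) ∣ i - c) B := by
  have hn5 := hz.five_le
  obtain ⟨c, hc⟩ := hz.exists_marked hA (by rw [hn]; decide)
  have hcn := (hz.marked_add c).2 hc
  obtain ⟨ε, he⟩ : ∃ ε, ε = rim z A c - rim z A (c + 1) := ⟨_, rfl⟩
  have hε : ε ≠ 0 := he ▸ sub_ne_zero.2 (hz.rim_ne_succ hA c)
  obtain ⟨B, hAB, hB, hB1, hB2, hB3⟩ := hz.exists_sweep hε n hA (P := c + 1)
    (Q := c + n) (by omega) (by omega) (by omega) (Or.inl (by simpa using hc)) (Or.inr hcn) (by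
      rw [hz.rim_add, he]
      push_cast
      rw [hn]
      ring)
  have hs : HasSlope z B ε (fun i => (n : ℤ) ∣ i - c) := by
    refine hz.hasSlope_of_window c (fun i k => natCast_dvd_add_mul_sub_iff i k c) ?_
    intro i h1 h2
    rw [natCast_dvd_sub_iff (by omega) h2]
    constructor
    · rintro rfl
      rw [hB1 _ le_rfl (by omega), ← hz.rim_add i, hB2 _ le_rfl (by omega), hz.rim_add, he]
      simp
    · intro h
      rw [hB1 (i + 1) (by omega) (by omega), hB1 i (by omega) (by omega)]
      push_cast
      ring
  have hne : ∀ i, c < i → i + 1 < c + n → rim z B i ≠ rim z B (i + 2) := by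
    intro i h1 h2
    rw [← one_add_one_eq_two, ← add_assoc,
      (hs _).2 (by beta_reduce; rw [natCast_dvd_sub_iff (by omega) (by omega)]; omega),
      (hs _).2 (by beta_reduce; rw [natCast_dvd_sub_iff (by omega) (by omega)]; omega)]
    generalize rim z B i = x
    clear * - hε
    revert x ε
    decide
  -- The places next to `c` are left out, since the slope changes there; they are unmarked anyway
  -- because `c` is marked.
  obtain ⟨C, hBC, hC, hC1, hC2, hC3⟩ := hz.exists_clear (n / 2) hB (P := c + 2) (Q := c + n - 1)
    (by omega) (hz.markCount_mono_le le_rfl (by omega)) (fun i h1 h2 => ⟨by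
        have := hne (i - 1) (by omega) (by omega)
        rwa [show i - 1 + 2 = i + 1 by ring] at this, hne i (by omega) (by omega)⟩)
  refine ⟨C, c, (hAB.trans hBC).mono ?_, hC, ⟨ε, hε, ?_⟩, ?_⟩
  · have := hz.cutCount_mono_le (A := A) (P := c + 1) (Q := c + n) le_rfl (by omega)
    omega
  · intro i
    rw [hC1, hC1]
    exact hs i
  · refine hz.marked_of_window (c - 1 + n) (fun i k => natCast_dvd_add_mul_sub_iff i k c) ?_
    intro i h1 h2
    rw [show i - c = i + n * (-1) + n * 1 - c by ring, natCast_dvd_add_mul_sub_iff,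
      natCast_dvd_sub_iff (by omega) (by omega)]
    rcases lt_or_ge i (c + n + 2) with h | h
    · rw [hC3 i (by omega) (by omega), hB3]
      have e1 := hz.not_marked_succ hcn
      have e2 := hz.not_marked_pred hcn
      constructor
      · intro hm
        by_contra hi
        rcases (show i = c + n - 1 ∨ i = c + n + 1 by omega) with rfl | rfl
        · exact e2 hm
        · exact e1 hm
      · intro hi
        rwa [show i = c + n by omega]
    · have := hC2 (i - n) (by omega) (by omega)
      rw [← hz.marked_add, sub_add_cancel] at this
      exact iff_of_false this (by omega)

omit hA in
-- With x the colour of `c`, the rim from c - 1 to c + 2 reads x - ε, x, x - ε, x, so three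
-- consecutive rim edges miss the same colour. Toggling this run moves the mark to c - 1 and c + 1.
-- Now c and c + 2 are cut, and the flip between them moves the exceptional edge one place on. The
-- surplus mark at c - 1 is then removed.
theorem exists_shift_two {c : ℤ}
    (h : HasPattern a z (fun i => (n : ℤ) ∣ i - c) (fun i => (n : ℤ) ∣ i - c) A) :
    ∃ B, KempeWithin 3 A B ∧
      HasPattern a z (fun i => (n : ℤ) ∣ i - (c + 1)) (fun i => (n : ℤ) ∣ i - (c + 1)) B := by
  have hn5 := hz.five_le
  obtain ⟨hA, ⟨ε, hε, hs⟩, hm⟩ := h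
  have h3 : (3 : ZMod 3) = 0 := by decide
  have hdiff : ∀ y ε : ZMod 3, ε ≠ 0 → y - ε ≠ y + ε ∧ y + ε ≠ y ∧ y - ε ≠ y := by decide
  obtain ⟨hd1, hd2, hd3⟩ := hdiff (rim z A c) ε hε
  have up : ∀ i, c < i → i < c + n → rim z A (i + 1) = rim z A i + ε := fun i h1 h2 =>
    (hs i).2 (by beta_reduce; rw [natCast_dvd_sub_iff (by omega) (by omega)]; omega)
  have up' : ∀ i, c - n < i → i < c → rim z A (i + 1) = rim z A i + ε := fun i h1 h2 =>
    (hs i).2 (by beta_reduce; rw [natCast_dvd_sub_iff (by omega) (by omega)]; omega)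
  have mk : ∀ i, c - n < i → i < c + n → (Marked z A i ↔ i = c) := fun i h1 h2 => by
    rw [hm]; exact natCast_dvd_sub_iff h1 h2
  have r1 : rim z A (c + 1) = rim z A c - ε := (hs c).1 (by simp)
  have r2 : rim z A (c + 2) = rim z A c := by
    have := up (c + 1) (by omega) (by omega)
    rw [add_assoc, one_add_one_eq_two] at this
    linear_combination this + r1
  have r3 : rim z A (c + 3) = rim z A c + ε := by
    have := up (c + 2) (by omega) (by omega)
    rw [add_assoc, show (2 : ℤ) + 1 = 3 by norm_num] at this
    linear_combination this + r2
  have r4 : rim z A (c - 1) = rim z A c - ε := by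
    have := up' (c - 1) (by omega) (by omega)
    rw [sub_add_cancel] at this
    linear_combination -this
  have r5 : rim z A (c - 2) = rim z A c + ε := by
    have := up' (c - 2) (by omega) (by omega)
    rw [show c - 2 + 1 = c - 1 by ring] at this
    linear_combination r4 - this - ε * h3
  obtain ⟨B, hAB, hB, hB1, hB2, hB3⟩ := hz.exists_toggle hA (j := c - 1) (l := c + 1)
    (-(rim z A c + rim z A c - ε)) (by omega) (by
      intro i h1 h2
      rcases (show i = c - 1 ∨ i = c ∨ i = c + 1 by omega) with rfl | rfl | rfl
      · rw [sub_add_cancel, r4]; ring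
      · rw [r1]; ring
      · rw [add_assoc, one_add_one_eq_two, r1, r2]; ring)
    (by rw [mk _ (by omega) (by omega)]; omega) (by rw [mk _ (by omega) (by omega)]; omega)
    (by rw [show c - 1 - 1 = c - 2 by ring, sub_add_cancel, r5]; exact hd2)
    (by rw [show c + 1 + 2 = c + 3 by ring, r1, r3]; exact hd1)
  have m1 : Marked z B (c - 1) := (hB2 _ le_rfl (by omega)).2 (by
    rw [mk _ (by omega) (by omega)]; omega)
  have m2 : Marked z B (c + 1) := (hB2 _ (by omega) le_rfl).2 (by
    rw [mk _ (by omega) (by omega)]; omega)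
  obtain ⟨C, hBC, hC, hC1, hC2, hC3⟩ := hz.exists_flip hB (j := c) (l := c + 2) (by omega)
    (by omega) (by rw [hB1, hB1, r2]) (Or.inl m1)
    (Or.inl (by rwa [show c + 2 - 1 = c + 1 by ring])) (by
      intro i h1 h2 _
      obtain rfl : i = c + 1 := by omega
      rw [hB1, hB1, r1]
      exact hd3)
  simp only [hB1] at hC1 hC2
  have s0 : rim z C c = rim z A c := by
    rw [hC1 c le_rfl (by omega)]; ring
  have s1 : rim z C (c + 1) = rim z A c + ε := by
    rw [hC1 _ (by omega) (by omega), r1]; ring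
  have hrest : ∀ i, c - n + 2 ≤ i → i ≤ c → rim z C i = rim z A i := by
    intro i h1 h2
    rw [← hz.rim_add, hC2 _ (by omega) (by omega), hz.rim_add]
  obtain ⟨E, hCE, hE, hE1, hE2, hE3⟩ := hz.exists_toggle_one hC (i := c - 1)
    (by
      rw [hC3, ← hz.marked_add, hB3 _ (by omega) (by omega), hz.marked_add,
        mk _ (by omega) (by omega)]
      omega)
    (by
      rw [hC3, sub_add_cancel, hB2 _ (by omega) (by omega), not_not, mk _ (by omega) (by omega)])
    (by
      rw [show c - 1 - 1 = c - 2 by ring, sub_add_cancel, s0, hrest _ (by omega) (by omega), r5]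
      exact hd2)
    (by
      rw [show c - 1 + 2 = c + 1 by ring, s1, hrest _ (by omega) (by omega), r4]
      exact hd1)
  refine ⟨E, (hAB.within.trans hBC.within).trans hCE.within, hE, ⟨ε, hε, ?_⟩, ?_⟩
  · have hsC : HasSlope z C ε (fun i => (n : ℤ) ∣ i - (c + 1)) := by
      refine hz.hasSlope_of_window c (fun i k => natCast_dvd_add_mul_sub_iff i k _) ?_
      intro i h1 h2
      rw [natCast_dvd_sub_iff (by omega) (by omega)]
      constructor
      · rintro rfl
        rw [show c + 1 + 1 = c + 2 by ring, hC2 _ le_rfl (by omega), s1, r2]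
        ring
      · intro h
        rcases h1.eq_or_lt with rfl | h1
        · rw [s1, s0]
        · rw [hC2 _ (by omega) (by omega), hC2 _ (by omega) (by omega), up i h1 h2]
    intro i
    rw [hE1, hE1]
    exact hsC i
  · refine hz.marked_of_window (c - 1) (fun i k => natCast_dvd_add_mul_sub_iff i k _) ?_
    intro i h1 h2
    rw [natCast_dvd_sub_iff (by omega) (by omega)]
    rcases h1.eq_or_lt with rfl | h1
    · rw [hE2, hC3]
      exact iff_of_false (not_not.2 m1) (by omega)
    · rw [hE3 i h1 h2, hC3]
      rcases le_or_gt i (c + 1) with h | h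
      · rw [hB2 i (by omega) h, mk i (by omega) (by omega)]
        omega
      · rw [hB3 i h h2, mk i (by omega) (by omega)]
        omega

end IsStrip
end Canonical
end KempeH
-- The case n ≡ 1 modulo 3, and the three bounds
namespace KempeH

section Canonical
variable {W : Type*} {H : SimpleGraph W} {n : ℕ} {a : W} {z : ℤ → W}
namespace IsStrip
variable (hz : IsStrip H n a z) {A : H.Coloring (Option (ZMod 3))} (hA : A a = none)
include hz hA

/-- At most one Kempe change leads to two edges of equal slope between two cut vertices. -/
theorem exists_uniform_pair (hn : ∃ i, Marked z A i) :
    ∃ B t, KempeWithin 1 A B ∧ B a = none ∧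
      rim z B (t + 2) - rim z B (t + 1) = rim z B (t + 1) - rim z B t ∧
      Cut z B t ∧ Cut z B (t + 2) := by
  have hn5 := hz.five_le
  obtain ⟨j, hj⟩ := hn
  have hlin : ∀ i, rim z A i ≠ rim z A (i + 2) →
      rim z A (i + 2) - rim z A (i + 1) = rim z A (i + 1) - rim z A i := by
    intro i h
    have h1 := hz.rim_ne_succ hA i
    have h2 := hz.rim_ne_succ hA (i + 1)
    rw [add_assoc, one_add_one_eq_two] at h2
    have key : ∀ x y w : ZMod 3, x ≠ y → y ≠ w → x ≠ w → w - y = y - x := by decide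
    exact key _ _ _ h1 h2 h
  have hj1 := hz.not_marked_succ hj
  by_cases hj2 : Marked z A (j + 2)
  · by_cases h1 : rim z A j = rim z A (j + 2)
    · by_cases h2 : rim z A (j + 1) = rim z A (j + 1 + 2)
      -- The rim zigzags from j to j + 3; recolouring j + 1 makes the last two edges uniform.
      · obtain ⟨B, hAB, hB, hB1, hB2, hB3⟩ := hz.exists_flip hA (j := j) (l := j + 2) (by omega)
          (by omega) h1 (Or.inr hj) (Or.inr hj2) (by
            intro i h3 h4 _
            obtain rfl : i = j + 1 := by omega
            exact (hz.rim_ne_succ hA j).symm)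
        refine ⟨B, j + 1, hAB.within, hB, ?_, Or.inl ?_, Or.inl ?_⟩
        · rw [hB2 (j + 1 + 2) (by omega) (by omega), hB2 (j + 1 + 1) (by omega) (by omega),
            hB1 (j + 1) (by omega) (by omega), ← h2, add_assoc, one_add_one_eq_two, ← h1]
          ring
        · rw [hB3, add_sub_cancel_right]
          exact hj
        · rw [hB3, show j + 1 + 2 - 1 = j + 2 by ring]
          exact hj2
      · refine ⟨A, j + 1, (KempeWithin.refl A).mono (by simp), hA, hlin _ h2, Or.inl ?_, Or.inl ?_⟩
        · rwa [add_sub_cancel_right]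
        · rwa [show j + 1 + 2 - 1 = j + 2 by ring]
    · exact ⟨A, j, (KempeWithin.refl A).mono (by simp), hA, hlin _ h1, Or.inr hj, Or.inr hj2⟩
  · have hj2' : ¬ Marked z A (j + 1 + 1) := by rwa [add_assoc, one_add_one_eq_two]
    have h1 := hz.rim_ne_of_not_marked hA hj1 hj2'
    by_cases hj3 : Marked z A (j + 3)
    · refine ⟨A, j + 1, (KempeWithin.refl A).mono (by simp), hA, hlin _ h1, Or.inl ?_, Or.inr ?_⟩
      · rwa [add_sub_cancel_right]
      · rwa [show j + 1 + 2 = j + 3 by ring]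
    · have hj3' : ¬ Marked z A (j + 2 + 1) := by rwa [show j + 2 + 1 = j + 3 by ring]
      -- Here the edges after j + 1 are already uniform, and a new mark at j + 2 makes their far end
      -- j + 3 a cut vertex.
      obtain ⟨B, hAB, hB, hB1, hB2, hB3⟩ := hz.exists_toggle_one hA (i := j + 2)
        (by rwa [show j + 2 - 1 = j + 1 by ring]) hj3'
        (by rwa [show j + 2 - 1 = j + 1 by ring, show j + 2 + 1 = j + 1 + 2 by ring])
        (hz.rim_ne_of_not_marked hA hj2 hj3')
      refine ⟨B, j + 1, hAB.within, hB, ?_, Or.inl ?_, Or.inl ?_⟩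
      · simp only [hB1]
        exact hlin _ h1
      · rwa [add_sub_cancel_right, ← hz.marked_add, hB3 _ (by omega) (by omega), hz.marked_add]
      · rw [show j + 1 + 2 - 1 = j + 2 by ring]
        exact hB2.2 hj2

/-- Moving a mark across a vertex of the rim at which the slope changes. -/
theorem exists_slide {j : ℤ} (h0 : rim z A j = rim z A (j + 2)) (hj : ¬ Marked z A (j - 1))
    (hj2 : ¬ Marked z A (j + 2)) (h1 : rim z A (j - 1) ≠ rim z A (j + 1))
    (h2 : rim z A (j + 1) ≠ rim z A (j + 3)) :
    ∃ B : H.Coloring (Option (ZMod 3)), KempeWithin 1 A B ∧ B a = none ∧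
      (∀ i, rim z B i = rim z A i) ∧ (Marked z B j ↔ ¬ Marked z A j) ∧
      (Marked z B (j + 1) ↔ ¬ Marked z A (j + 1)) ∧
      (∀ i, j + 1 < i → i < j + n → (Marked z B i ↔ Marked z A i)) := by
  obtain ⟨B, hAB, hB, hB1, hB2, hB3⟩ := hz.exists_toggle hA (j := j) (l := j + 1)
    -- By `h0` the rim edges at `j` and `j + 1` miss the same colour and form a run of length two;
    -- if exactly one of them is marked, the toggle moves that mark to the other.
    (-(rim z A j + rim z A (j + 1))) (by omega) (by
      intro i h3 h4
      rcases (show i = j ∨ i = j + 1 by omega) with rfl | rfl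
      · rfl
      · rw [add_assoc, one_add_one_eq_two, ← h0, add_comm]) hj
    (by rwa [add_assoc, one_add_one_eq_two]) h1 (by rwa [show j + 1 + 2 = j + 3 by ring])
  exact ⟨B, hAB.within, hB, hB1, hB2 _ le_rfl (by omega), hB2 _ (by omega) le_rfl, hB3⟩

/-- The marks at the ends of a run of two exceptional edges can be brought to a standard form. -/
theorem exists_normal_marks (hn7 : 7 ≤ n) {t : ℤ} {ε : ZMod 3} (hε : ε ≠ 0)
    (hs : HasSlope z A ε (fun i => (n : ℤ) ∣ i - t ∨ (n : ℤ) ∣ i - (t + 1)))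
    (hm : ∀ i, t + 3 ≤ i → i < t + n - 1 → ¬ Marked z A i) (ht : Cut z A t)
    (ht2 : Cut z A (t + 2)) :
    ∃ B, KempeWithin 2 A B ∧
      HasPattern a z (fun i => (n : ℤ) ∣ i - t ∨ (n : ℤ) ∣ i - (t + 1))
        (fun i => (n : ℤ) ∣ i - (t - 1) ∨ (n : ℤ) ∣ i - (t + 1)) B := by
  have h3 : (3 : ZMod 3) = 0 := by decide
  obtain ⟨x, hx⟩ : ∃ x, x = rim z A t := ⟨_, rfl⟩
  have hdiff : ∀ y ε : ZMod 3, ε ≠ 0 → y - ε ≠ y + ε ∧ y + ε ≠ y ∧ y - ε ≠ y := by decide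
  obtain ⟨hd1, hd2, hd3⟩ := hdiff x ε hε
  have up : ∀ i, t + 1 < i → i < t + n → rim z A (i + 1) = rim z A i + ε := fun i h1 h2 =>
    (hs i).2 (by
      beta_reduce
      rw [natCast_dvd_sub_iff (by omega) (by omega),
        natCast_dvd_sub_iff (by omega) (by omega)]
      omega)
  have up' : ∀ i, t - n + 1 < i → i < t → rim z A (i + 1) = rim z A i + ε := fun i h1 h2 =>
    (hs i).2 (by
      beta_reduce
      rw [natCast_dvd_sub_iff (by omega) (by omega),
        natCast_dvd_sub_iff (by omega) (by omega)]
      omega)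
  have r0 : rim z A t = x := hx.symm
  have r1 : rim z A (t + 1) = x - ε := hx ▸ (hs t).1 (by simp)
  have r2 : rim z A (t + 2) = x + ε := by
    have := (hs (t + 1)).1 (by simp)
    rw [add_assoc, one_add_one_eq_two] at this
    linear_combination this + r1 - ε * h3
  have r3 : rim z A (t + 3) = x - ε := by
    have := up (t + 2) (by omega) (by omega)
    rw [add_assoc, show (2 : ℤ) + 1 = 3 by norm_num] at this
    linear_combination this + r2 + ε * h3
  have r4 : rim z A (t + 4) = x := by
    have := up (t + 3) (by omega) (by omega)
    rw [add_assoc, show (3 : ℤ) + 1 = 4 by norm_num] at this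
    linear_combination this + r3
  have r5 : rim z A (t - 1) = x - ε := by
    have := up' (t - 1) (by omega) (by omega)
    rw [sub_add_cancel] at this
    linear_combination r0 - this
  have r6 : rim z A (t - 2) = x + ε := by
    have := up' (t - 2) (by omega) (by omega)
    rw [show t - 2 + 1 = t - 1 by ring] at this
    linear_combination r5 - this - ε * h3
  -- the mark at the left end
  obtain ⟨B, hAB, hB, hB1, hB2, hB3, hB4⟩ : ∃ B : H.Coloring (Option (ZMod 3)),
      KempeWithin 1 A B ∧ B a = none ∧ (∀ i, rim z B i = rim z A i) ∧ Marked z B (t - 1) ∧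
      (∀ i, t + 3 ≤ i → i < t + n - 1 → ¬ Marked z B i) ∧ Cut z B (t + 2) := by
    -- The slope changes at `t`, so a mark at `t` can slide across it to `t - 1`. Likewise a mark at
    -- `t + 2` slides to `t + 1`.
    by_cases h : Marked z A t
    · obtain ⟨B, hAB, hB, hB1, hB2, hB3, hB4⟩ := hz.exists_slide hA (j := t - 1)
        (by rw [show t - 1 + 2 = t + 1 by ring, r5, r1])
        (by
          rw [← hz.marked_add]
          exact hm _ (by omega) (by omega))
        (by
          rw [show t - 1 + 2 = t + 1 by ring]
          exact hz.not_marked_succ h)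
        (by
          rw [show t - 1 - 1 = t - 2 by ring, sub_add_cancel, r6, r0]
          exact hd2)
        (by
          rw [show t - 1 + 3 = t + 2 by ring, sub_add_cancel, r2, r0]
          exact hd2.symm)
      refine ⟨B, hAB, hB, hB1, hB2.2 (hz.not_marked_pred h), ?_, ?_⟩
      · intro i h1 h2
        rw [hB4 i (by omega) (by omega)]
        exact hm i h1 h2
      · unfold Cut at ht2 ⊢
        rwa [hB4 _ (by omega) (by omega), hB4 _ (by omega) (by omega)]
    · exact ⟨A, (KempeWithin.refl A).mono (by simp), hA, fun _ => rfl, ht.resolve_right h, hm, ht2⟩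
  have b0 : ¬ Marked z B t := by
    have := hz.not_marked_succ hB2
    rwa [sub_add_cancel] at this
  -- the mark at the right end
  obtain ⟨C, hBC, hC, hC1, hC2, hC3, hC4⟩ : ∃ C : H.Coloring (Option (ZMod 3)),
      KempeWithin 1 B C ∧ C a = none ∧ (∀ i, rim z C i = rim z B i) ∧ Marked z C (t + 1) ∧
      Marked z C (t - 1) ∧ (∀ i, t + 3 ≤ i → i < t + n - 1 → ¬ Marked z C i) := by
    by_cases h : Marked z B (t + 2)
    · obtain ⟨C, hBC, hC, hC1, hC2, hC3, hC4⟩ := hz.exists_slide hB (j := t + 1)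
        (by rw [show t + 1 + 2 = t + 3 by ring, hB1, hB1, r1, r3])
        (by rwa [add_sub_cancel_right])
        (by
          rw [show t + 1 + 2 = t + 2 + 1 by ring]
          exact hz.not_marked_succ h)
        (by
          rw [add_sub_cancel_right, show t + 1 + 1 = t + 2 by ring, hB1, hB1, r0, r2]
          exact hd2.symm)
        (by
          rw [show t + 1 + 3 = t + 4 by ring, show t + 1 + 1 = t + 2 by ring, hB1, hB1, r2, r4]
          exact hd2)
      refine ⟨C, hBC, hC, hC1, hC2.2 ?_, ?_, ?_⟩
      · have := hz.not_marked_pred h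
        rwa [show t + 2 - 1 = t + 1 by ring] at this
      · rwa [← hz.marked_add, hC4 _ (by omega) (by omega), hz.marked_add]
      · intro i h1 h2
        rw [hC4 i (by omega) (by omega)]
        exact hB3 i h1 h2
    · refine ⟨B, (KempeWithin.refl B).mono (by simp), hB, fun _ => rfl, ?_, hB2, hB3⟩
      have := hB4.resolve_right h
      rwa [show t + 2 - 1 = t + 1 by ring] at this
  refine ⟨C, hAB.trans hBC, hC, ⟨ε, hε, ?_⟩, ?_⟩
  · intro i
    rw [hC1, hC1, hB1, hB1]
    exact hs i
  · refine hz.marked_of_window (t - 1) (fun i k => by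
      rw [natCast_dvd_add_mul_sub_iff, natCast_dvd_add_mul_sub_iff]) ?_
    intro i h1 h2
    rw [natCast_dvd_sub_iff (by omega) (by omega),
      natCast_dvd_sub_iff (by omega) (by omega)]
    have e1 := hz.not_marked_succ hC3
    have e2 := hz.not_marked_succ hC2
    rw [sub_add_cancel] at e1
    rw [add_assoc, one_add_one_eq_two] at e2
    rcases (show i = t - 1 ∨ i = t ∨ i = t + 1 ∨ i = t + 2 ∨ t + 3 ≤ i by omega) with
      rfl | rfl | rfl | rfl | h
    · simp [hC3]
    · exact iff_of_false e1 (by omega)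
    · simp [hC2]
    · exact iff_of_false e2 (by omega)
    · exact iff_of_false (hC4 i h (by omega)) (by omega)

/-- Two edges of slope `-ε` and n - 2 of slope `ε` add up to (n - 4)ε = 0. The cost is 1 for a
uniform pair between cut vertices, 3⌊n/2⌋ for sweeping and clearing the rest, and 2 for normalising
the marks. -/
theorem exists_pattern_one (hn7 : 7 ≤ n) (hn : (n : ZMod 3) = 1) :
    ∃ B t, KempeWithin (3 * (n / 2) + 3) A B ∧
      HasPattern a z (fun i => (n : ℤ) ∣ i - t ∨ (n : ℤ) ∣ i - (t + 1))
        (fun i => (n : ℤ) ∣ i - (t - 1) ∨ (n : ℤ) ∣ i - (t + 1)) B := by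
  have h3 : (3 : ZMod 3) = 0 := by decide
  obtain ⟨A', t, hAA', hA', hlin, ht, ht2⟩ :=
    hz.exists_uniform_pair hA (hz.exists_marked hA (by rw [hn]; decide))
  obtain ⟨ε, he⟩ : ∃ ε, ε = rim z A' t - rim z A' (t + 1) := ⟨_, rfl⟩
  have hε : ε ≠ 0 := he ▸ sub_ne_zero.2 (hz.rim_ne_succ hA' t)
  obtain ⟨B, hAB, hB, hB1, hB2, hB3⟩ := hz.exists_sweep hε n hA' (P := t + 2)
    (Q := t + n) (by omega) (by omega) (by omega) ht2 ((hz.cut_add t).2 ht) (by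
      rw [hz.rim_add]
      push_cast
      rw [hn]
      linear_combination -hlin + he + (rim z A' t - rim z A' (t + 1)) * h3)
  have hback : ∀ i, t ≤ i → i ≤ t + 2 → rim z B i = rim z A' i := by
    intro i h1 h2
    rw [← hz.rim_add, hB2 _ (by omega) (by omega), hz.rim_add]
  have hs : HasSlope z B ε (fun i => (n : ℤ) ∣ i - t ∨ (n : ℤ) ∣ i - (t + 1)) := by
    refine hz.hasSlope_of_window t (fun i k => by
      rw [natCast_dvd_add_mul_sub_iff, natCast_dvd_add_mul_sub_iff]) ?_
    intro i h1 h2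
    rw [natCast_dvd_sub_iff (by omega) (by omega),
      natCast_dvd_sub_iff (by omega) (by omega)]
    constructor
    · rintro (rfl | rfl)
      · rw [hback _ (by omega) (by omega), hback _ (by omega) (by omega), he]
        ring
      · rw [hback _ (by omega) (by omega), hback _ (by omega) (by omega), he, add_assoc,
          one_add_one_eq_two]
        linear_combination hlin
    · intro h
      rw [hB1 (i + 1) (by omega) (by omega), hB1 i (by omega) (by omega)]
      push_cast
      ring
  have hne : ∀ i, t + 1 < i → i + 1 < t + n → rim z B i ≠ rim z B (i + 2) := by
    intro i h1 h2
    have up : ∀ k, t + 1 < k → k < t + n → rim z B (k + 1) = rim z B k + ε := fun k h1 h2 =>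
      (hs k).2 (by
        beta_reduce
        rw [natCast_dvd_sub_iff (by omega) (by omega),
          natCast_dvd_sub_iff (by omega) (by omega)]
        omega)
    rw [← one_add_one_eq_two, ← add_assoc, up _ (by omega) (by omega), up _ (by omega) (by omega)]
    generalize rim z B i = x
    clear * - hε
    revert x ε
    decide
  obtain ⟨C, hBC, hC, hC1, hC2, hC3⟩ := hz.exists_clear (n / 2) hB (P := t + 3) (Q := t + n - 1)
    (by omega) (hz.markCount_mono_le le_rfl (by omega)) (fun i h1 h2 => ⟨by
        have := hne (i - 1) (by omega) (by omega)
        rwa [show i - 1 + 2 = i + 1 by ring] at this, hne i (by omega) (by omega)⟩)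
  have hkeep : ∀ i, t - 1 ≤ i → i ≤ t + 2 → (Marked z C i ↔ Marked z A' i) := by
    intro i h1 h2
    rw [← hz.marked_add, hC3 _ (by omega) (by omega), hz.marked_add, hB3]
  obtain ⟨E, hCE, hE⟩ := hz.exists_normal_marks hC hn7 hε (t := t) (fun i => by
      rw [hC1, hC1]
      exact hs i) hC2
    (by
      unfold Cut at ht ⊢
      rwa [hkeep _ (by omega) (by omega), hkeep _ (by omega) (by omega)])
    (by
      unfold Cut at ht2 ⊢
      rwa [hkeep _ (by omega) (by omega), hkeep _ (by omega) (by omega)])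
  refine ⟨E, t, (((hAA'.trans hAB).trans hBC).trans hCE).mono ?_, hE⟩
  have := hz.cutCount_mono_le (A := A') (P := t + 2) (Q := t + n) le_rfl (by omega)
  omega

omit hA in
-- With x the colour of `c`, the rim from c - 1 to c + 2 reads x - ε, x, x - ε, x + ε. The flip on
-- [c - 1, c + 1] changes the second entry to x + ε, and the flip on [c, c + 2] then changes the
-- third to x, so the exceptional pair moves one place back. The two remaining changes slide the
-- marks after it.
theorem exists_shift_one (hn7 : 7 ≤ n) {c : ℤ}
    (h : HasPattern a z (fun i => (n : ℤ) ∣ i - c ∨ (n : ℤ) ∣ i - (c + 1))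
        (fun i => (n : ℤ) ∣ i - (c - 1) ∨ (n : ℤ) ∣ i - (c + 1)) A) :
    ∃ B, KempeWithin 4 A B ∧
      HasPattern a z (fun i => (n : ℤ) ∣ i - (c - 1) ∨ (n : ℤ) ∣ i - (c - 1 + 1))
        (fun i => (n : ℤ) ∣ i - (c - 1 - 1) ∨ (n : ℤ) ∣ i - (c - 1 + 1)) B := by
  obtain ⟨hA, ⟨ε, hε, hs⟩, hm⟩ := h
  have h3 : (3 : ZMod 3) = 0 := by decide
  obtain ⟨x, hx⟩ : ∃ x, x = rim z A c := ⟨_, rfl⟩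
  have hdiff : ∀ y ε : ZMod 3, ε ≠ 0 → y - ε ≠ y + ε ∧ y + ε ≠ y ∧ y - ε ≠ y := by decide
  obtain ⟨hd1, hd2, hd3⟩ := hdiff x ε hε
  have up : ∀ i, c + 1 < i → i < c + n → rim z A (i + 1) = rim z A i + ε := fun i h1 h2 =>
    (hs i).2 (by
      beta_reduce
      rw [natCast_dvd_sub_iff (by omega) (by omega),
        natCast_dvd_sub_iff (by omega) (by omega)]
      omega)
  have mk : ∀ i, c - 1 ≤ i → i < c + n - 1 → (Marked z A i ↔ i = c - 1 ∨ i = c + 1) :=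
    fun i h1 h2 => by
      rw [hm]
      beta_reduce
      rw [natCast_dvd_sub_iff (by omega) (by omega),
        natCast_dvd_sub_iff (by omega) (by omega)]
  have m1 : Marked z A (c - 1) := (mk _ (by omega) (by omega)).2 (by simp)
  have m2 : Marked z A (c + 1) := (mk _ (by omega) (by omega)).2 (by simp)
  have r1 : rim z A (c + 1) = x - ε := hx ▸ (hs c).1 (by simp)
  have r2 : rim z A (c + 2) = x + ε := by
    have := (hs (c + 1)).1 (by simp)
    rw [add_assoc, one_add_one_eq_two] at this
    linear_combination this + r1 - ε * h3
  have r5 : rim z A (c - 1) = x - ε := by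
    have := up (c + n - 1) (by omega) (by omega)
    rw [sub_add_cancel, hz.rim_add, show c + n - 1 = c - 1 + n by ring, hz.rim_add] at this
    linear_combination -hx - this
  obtain ⟨B, hAB, hB, hB1, hB2, hB3⟩ := hz.exists_flip hA (j := c - 1) (l := c + 1) (by omega)
    (by omega) (by rw [r5, r1]) (Or.inr m1) (Or.inr m2) (by
      intro i h1 h2 _
      obtain rfl : i = c := by omega
      rw [r5, ← hx]
      exact hd3.symm)
  have b0 : rim z B c = x + ε := by
    rw [hB1 c (by omega) (by omega), r5, ← hx]
    linear_combination -ε * h3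
  have b1 : rim z B (c + 1) = x - ε := by rw [hB2 _ le_rfl (by omega), r1]
  have b2 : rim z B (c + 2) = x + ε := by rw [hB2 _ (by omega) (by omega), r2]
  obtain ⟨C, hBC, hC, hC1, hC2, hC3⟩ := hz.exists_flip hB (j := c) (l := c + 2) (by omega)
    (by omega) (by rw [b0, b2]) (Or.inl ((hB3 _).2 m1))
    (Or.inl ((hB3 _).2 (by rwa [show c + 2 - 1 = c + 1 by ring]))) (by
      intro i h1 h2 _
      obtain rfl : i = c + 1 := by omega
      rw [b0, b1]
      exact hd1)
  have c0 : rim z C c = x + ε := by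
    rw [hC1 _ le_rfl (by omega), b0]
    ring
  have c1 : rim z C (c + 1) = x := by
    rw [hC1 _ (by omega) (by omega), b0, b1]
    linear_combination ε * h3
  have crest : ∀ i, c + 2 ≤ i → i ≤ c + n - 1 → rim z C i = rim z A i := by
    intro i h1 h2
    rw [hC2 i h1 (by omega), hB2 i (by omega) (by omega)]
  have cm : rim z C (c - 1) = x - ε := by
    rw [← hz.rim_add, crest _ (by omega) (by omega), hz.rim_add, r5]
  have hmark : ∀ i, Marked z C i ↔ Marked z A i := fun i => (hC3 i).trans (hB3 i)
  have hsC : HasSlope z C ε (fun i => (n : ℤ) ∣ i - (c - 1) ∨ (n : ℤ) ∣ i - (c - 1 + 1)) := by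
    refine hz.hasSlope_of_window (c - 1) (fun i k => by
      rw [natCast_dvd_add_mul_sub_iff, natCast_dvd_add_mul_sub_iff]) ?_
    intro i h1 h2
    rw [natCast_dvd_sub_iff (by omega) (by omega),
      natCast_dvd_sub_iff (by omega) (by omega)]
    constructor
    · rintro (rfl | h)
      · rw [sub_add_cancel, c0, cm]
        linear_combination ε * h3
      · obtain rfl : i = c := by omega
        rw [c0, c1]
        ring
    · intro h
      rcases (show i = c + 1 ∨ c + 2 ≤ i by omega) with rfl | h
      · rw [add_assoc, one_add_one_eq_two, crest _ le_rfl (by omega), r2, c1]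
      · rcases (show i = c + n - 2 ∨ i < c + n - 2 by omega) with rfl | h'
        · rw [crest _ h (by omega), crest _ (by omega) (by omega)]
          exact up _ (by omega) (by omega)
        · rw [crest _ h (by omega), crest _ (by omega) (by omega)]
          exact up _ (by omega) (by omega)
  obtain ⟨E, hCE, hE⟩ := hz.exists_normal_marks hC hn7 hε hsC
    (by
      intro i h1 h2
      rw [hmark, mk i (by omega) (by omega)]
      omega)
    (Or.inr ((hmark _).2 m1))
    (Or.inr ((hmark _).2 (by rwa [show c - 1 + 2 = c + 1 by ring])))
  exact ⟨E, (hAB.within.trans hBC.within).trans hCE, hE⟩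

omit hA in
/-- The bounds for two colourings in which the vertex `a` has the same colour. -/
theorem kempeEquivalentWithin {B : H.Coloring (Option (ZMod 3))} (hA : A a = none)
    (hB : B a = none) :
    (n % 3 = 0 → KempeEquivalentWithin (6 * (n / 2)) A B) ∧
    (n % 3 = 2 → KempeEquivalentWithin (9 * (n / 2)) A B) ∧
    (n % 3 = 1 → KempeEquivalentWithin (9 * (n / 2) + 6 * (n / 3) - 2) A B) := by
  have hn5 := hz.five_le
  have hcast : ((n % 3 : ℕ) : ZMod 3) = n := ZMod.natCast_mod n 3
  refine ⟨fun h => ?_, fun h => ?_, fun h => ?_⟩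
  · rw [h] at hcast
    obtain ⟨A', hA1, hA2⟩ := hz.exists_pattern_zero hA hcast.symm
    obtain ⟨B', hB1, hB2⟩ := hz.exists_pattern_zero hB hcast.symm
    exact (kempeEquivalentWithin_of_meet hA1 hB1 (hz.equalUpToPerm hA2 hB2)).mono (by omega)
  · rw [h] at hcast
    refine (hz.kempeEquivalentWithin_of_rotation (r := 3) (m := 3 * (n / 2))
      (F := fun c => HasPattern a z (fun i => (n : ℤ) ∣ i - c) (fun i => (n : ℤ) ∣ i - c))
      ?_ (fun c A B => hz.equalUpToPerm) (fun c A => hz.exists_shift_two)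
      (fun A hA => hz.exists_pattern_two hA hcast.symm) hA hB).mono (by omega)
    intro c k A
    have e : ∀ i, (n : ℤ) ∣ i - (c + n * k) ↔ (n : ℤ) ∣ i - c := by
      intro i
      rw [← natCast_dvd_add_mul_sub_iff i k]
      ring_nf
    simp only [e]
  · rw [h] at hcast
    -- The total 10⌊n/2⌋ + 6 is within the bound, since here n ≥ 7. The family is indexed by `-c`
    -- because the shift goes backwards.
    refine (hz.kempeEquivalentWithin_of_rotation (r := 4) (m := 3 * (n / 2) + 3)
      (F := fun c => HasPattern a z
        (fun i => (n : ℤ) ∣ i - (-c) ∨ (n : ℤ) ∣ i - (-c + 1))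
        (fun i => (n : ℤ) ∣ i - (-c - 1) ∨ (n : ℤ) ∣ i - (-c + 1)))
      ?_ (fun c A B => hz.equalUpToPerm) ?_ ?_ hA hB).mono (by omega)
    · intro c k A
      have e : ∀ i d, (n : ℤ) ∣ i - (-(c + n * k) + d) ↔ (n : ℤ) ∣ i - (-c + d) := by
        intro i d
        rw [← natCast_dvd_add_mul_sub_iff i (-k)]
        ring_nf
      have e0 : ∀ i, (n : ℤ) ∣ i - (-(c + n * k)) ↔ (n : ℤ) ∣ i - (-c) := by
        intro i
        simpa using e i 0
      simp only [sub_eq_add_neg (-_ : ℤ) 1, e, e0]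
    · intro c A h
      obtain ⟨B, h1, h2⟩ := hz.exists_shift_one (by omega) h
      refine ⟨B, h1, ?_⟩
      rwa [show -(c + 1) = -c - 1 by ring]
    · intro A hA
      obtain ⟨B, t, h1, h2⟩ := hz.exists_pattern_one hA (by omega) hcast.symm
      exact ⟨B, -t, h1, by rwa [neg_neg]⟩

end IsStrip
end Canonical
end KempeH
-- From the plane triangulation to the strip
namespace KempeH

/-- The number of points in the cycle of `x` is the period of `x`. -/
theorem zpow_apply_eq_self_iff_of_ncard {α : Type*} {f : Equiv.Perm α} {x : α} {k : ℕ}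
    (hk : {y | f.SameCycle x y}.ncard = k) (i : ℤ) : (f ^ i) x = x ↔ (k : ℤ) ∣ i := by
  have e : {y | f.SameCycle x y} = MulAction.orbit (Subgroup.zpowers f) x := by
    ext y
    simp only [Set.mem_ofPred_eq, MulAction.mem_orbit_iff, Equiv.Perm.SameCycle]
    constructor
    · rintro ⟨i, hi⟩
      exact ⟨⟨f ^ i, i, rfl⟩, hi⟩
    · rintro ⟨⟨g, i, rfl⟩, hi⟩
      exact ⟨i, hi⟩
  have h := MulAction.zpow_smul_eq_iff_minimalPeriod_dvd (a := f) (b := x) (n := i)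
  rw [Equiv.Perm.smul_def] at h
  rw [h, ← hk, e, ← Nat.card_coe_set_eq, Nat.card_congr (MulAction.orbitZPowersEquiv f x),
    Nat.card_zmod]

namespace RotationSystem
variable {V : Type*} {G : SimpleGraph V} (R : RotationSystem G)

/-- `R.Next y x x'`: in the rotation at `y`, the neighbour `x` is followed by `x'`. -/
def Next (y x x' : V) : Prop :=
  ∃ (h : G.Adj y x) (h' : G.Adj y x'), R.rot ⟨(y, x), h⟩ = ⟨(y, x'), h'⟩

variable {R}

theorem Next.adj {y x x' : V} (h : R.Next y x x') : G.Adj y x := h.1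

theorem Next.adj' {y x x' : V} (h : R.Next y x x') : G.Adj y x' := h.2.1

theorem Next.right_unique {y x x' x'' : V} (h : R.Next y x x') (h' : R.Next y x x'') :
    x' = x'' := by
  obtain ⟨h1, h2, h3⟩ := h
  obtain ⟨h1', h2', h3'⟩ := h'
  rw [h3] at h3'
  simpa using congrArg (fun d : G.Dart => d.snd) h3'

theorem Next.left_unique {y x x' x'' : V} (h : R.Next y x x'') (h' : R.Next y x' x'') :
    x = x' := by
  obtain ⟨h1, h2, h3⟩ := h
  obtain ⟨h1', h2', h3'⟩ := h'
  have := R.rot.injective (h3.trans h3'.symm)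
  simpa using congrArg (fun d : G.Dart => d.snd) this

theorem exists_next {y x : V} (h : G.Adj y x) : ∃ x', R.Next y x x' := by
  have hf := R.fst_rot ⟨(y, x), h⟩
  rcases hd : R.rot ⟨(y, x), h⟩ with ⟨⟨p, q⟩, hpq⟩
  rw [hd] at hf
  obtain rfl : p = y := hf
  exact ⟨q, h, hpq, hd⟩

theorem exists_prev {y x' : V} (h : G.Adj y x') : ∃ x, R.Next y x x' := by
  have hf := R.fst_rot (R.rot.symm ⟨(y, x'), h⟩)
  rw [Equiv.apply_symm_apply] at hf
  rcases hd : R.rot.symm ⟨(y, x'), h⟩ with ⟨⟨p, q⟩, hpq⟩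
  rw [hd] at hf
  obtain rfl : y = p := hf
  exact ⟨q, hpq, h, by rw [← hd, Equiv.apply_symm_apply]⟩

/-- In a triangulation the three rotations at the corners of a face fit together. -/
theorem Next.triangle (hR : ∀ d : G.Dart, {d' : G.Dart | R.face.SameCycle d d'}.ncard = 3)
    {y x x' : V} (h : R.Next y x x') : R.Next x' y x ∧ R.Next x x' y := by
  obtain ⟨h1, h2, h3⟩ := h
  have hface : ∀ (p q r : V) (h : G.Adj p q) (h' : G.Adj q p) (h'' : G.Adj q r),
      R.rot ⟨(q, p), h'⟩ = ⟨(q, r), h''⟩ → R.face ⟨(p, q), h⟩ = ⟨(q, r), h''⟩ :=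
    fun p q r h h' h'' e => e
  obtain ⟨q, g1, g2, g3⟩ := exists_next (R := R) h2.symm
  obtain ⟨s, k1, k2, k3⟩ := exists_next (R := R) g2.symm
  have e := (zpow_apply_eq_self_iff_of_ncard (hR ⟨(x, y), h1.symm⟩) 3).2 (by simp)
  have e' : R.face (R.face (R.face ⟨(x, y), h1.symm⟩)) = ⟨(x, y), h1.symm⟩ := e
  rw [hface _ _ _ h1.symm h1 h2 h3, hface _ _ _ h2 h2.symm g2 g3,
    hface _ _ _ g2 g2.symm k2 k3] at e'
  obtain rfl : q = x := congrArg (fun d : G.Dart => d.fst) e'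
  obtain rfl : s = y := congrArg (fun d : G.Dart => d.snd) e'
  exact ⟨⟨g1, g2, g3⟩, k1, k2, k3⟩

theorem rot_zpow_fst (d : G.Dart) (i : ℤ) : ((R.rot ^ i) d).fst = d.fst := by
  induction i using Int.induction_on with
  | zero => rfl
  | succ i ih => rw [add_comm, zpow_add, Equiv.Perm.mul_apply, zpow_one, R.fst_rot, ih]
  | pred i ih =>
    rw [← ih, ← R.fst_rot, ← Equiv.Perm.mul_apply, ← zpow_one_add]
    congr 3
    ring_nf

variable [Fintype V] [DecidableRel G.Adj]

theorem rot_zpow_eq_self_iff (d : G.Dart) (i : ℤ) :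
    (R.rot ^ i) d = d ↔ (G.degree d.fst : ℤ) ∣ i := by
  classical
  apply zpow_apply_eq_self_iff_of_ncard
  rw [← G.dart_fst_fiber_card_eq_degree, ← Set.ncard_coe_finset]
  congr 1
  ext d'
  simp only [Set.mem_ofPred_eq, Finset.coe_filter, Finset.mem_univ, true_and]
  constructor
  · rintro ⟨i, rfl⟩
    exact rot_zpow_fst d i
  · intro h
    exact R.sameCycle _ _ h.symm

/-- A sequence of successive neighbours of `v` runs through all neighbours periodically. -/
theorem next_sequence {v : V} {x : ℤ → V} (hx : ∀ i, R.Next v (x i) (x (i + 1))) :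
    (∀ i j, x i = x j ↔ (G.degree v : ℤ) ∣ i - j) ∧ ∀ y, G.Adj v y → ∃ i, y = x i := by
  have key : ∀ i, (R.rot ^ i) ⟨(v, x 0), (hx 0).adj⟩ = ⟨(v, x i), (hx i).adj⟩ := by
    intro i
    induction i using Int.induction_on with
    | zero => rfl
    | succ i ih =>
      rw [add_comm, zpow_add, Equiv.Perm.mul_apply, zpow_one, ih]
      obtain ⟨h1, h2, h3⟩ := hx i
      simp only [add_comm (1 : ℤ)]
      exact h3
    | pred i ih =>
      apply R.rot.injective
      rw [← Equiv.Perm.mul_apply, ← zpow_one_add, show 1 + (-(i : ℤ) - 1) = -i by ring, ih]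
      obtain ⟨h1, h2, h3⟩ := hx (-i - 1)
      rw [h3]
      congr 2
      ring_nf
  constructor
  · intro i j
    rw [← rot_zpow_eq_self_iff (R := R) ⟨(v, x j), (hx j).adj⟩, ← key j, ← Equiv.Perm.mul_apply,
      ← zpow_add, sub_add_cancel, key, key]
    constructor
    · intro h
      simp only [h]
    · intro h
      exact congrArg (fun d : G.Dart => d.snd) h
  · intro y hy
    obtain ⟨i, hi⟩ := R.sameCycle ⟨(v, x 0), (hx 0).adj⟩ ⟨(v, y), hy⟩ rfl
    rw [key] at hi
    exact ⟨i, congrArg (fun d : G.Dart => d.snd) hi.symm⟩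

omit [Fintype V] [DecidableRel G.Adj] in
theorem exists_next_sequence {v x₀ : V} (h : G.Adj v x₀) :
    ∃ x : ℤ → V, x 0 = x₀ ∧ ∀ i, R.Next v (x i) (x (i + 1)) := by
  refine ⟨fun i => ((R.rot ^ i) ⟨(v, x₀), h⟩).snd, rfl, fun i => ?_⟩
  have hfst := rot_zpow_fst (R := R) ⟨(v, x₀), h⟩
  have hdart : ∀ (d : G.Dart), d.fst = v → ∃ h : G.Adj v d.snd, d = ⟨(v, d.snd), h⟩ := by
    rintro ⟨⟨p, q⟩, hpq⟩ rfl
    exact ⟨hpq, rfl⟩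
  obtain ⟨h1, e1⟩ := hdart _ (hfst i)
  obtain ⟨h2, e2⟩ := hdart _ (hfst (i + 1))
  refine ⟨h1, h2, ?_⟩
  rw [← e1, ← e2, add_comm, zpow_add, Equiv.Perm.mul_apply, zpow_one]

/-- The rotation at a vertex of degree `5`. -/
theorem next_of_degree_five {v x₀ x₁ x₂ x₃ x₄ : V} (hv : G.degree v = 5) (h0 : R.Next v x₀ x₁)
    (h1 : R.Next v x₁ x₂) (h2 : R.Next v x₂ x₃) (h3 : R.Next v x₃ x₄) :
    R.Next v x₄ x₀ ∧ (∀ y, G.Adj v y → y = x₀ ∨ y = x₁ ∨ y = x₂ ∨ y = x₃ ∨ y = x₄) ∧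
      x₀ ≠ x₂ ∧ x₀ ≠ x₃ ∧ x₁ ≠ x₄ ∧ x₂ ≠ x₄ := by
  obtain ⟨x, rfl, hx⟩ := exists_next_sequence (R := R) h0.adj
  obtain rfl : x 1 = x₁ := (hx 0).right_unique h0
  obtain rfl : x 2 = x₂ := (hx 1).right_unique h1
  obtain rfl : x 3 = x₃ := (hx 2).right_unique h2
  obtain rfl : x 4 = x₄ := (hx 3).right_unique h3
  obtain ⟨heq, hall⟩ := next_sequence hx
  rw [hv] at heq
  refine ⟨?_, ?_, ?_, ?_, ?_, ?_⟩
  · have := hx 4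
    rwa [(heq (4 + 1) 0).2 (by norm_num)] at this
  · intro y hy
    obtain ⟨i, rfl⟩ := hall y hy
    simp only [heq]
    push_cast
    omega
  all_goals
    rw [ne_eq, heq]
    norm_num

end RotationSystem

/-- `G - b` is the strip: the square of an even cycle together with the pole `a`. -/
theorem IsPolarTriangulation.exists_isStrip {V : Type*} [Fintype V] {G : SimpleGraph V}
    [DecidableRel G.Adj] {n : ℕ} (hn : 5 ≤ n) {a b : V} (hG : IsPolarTriangulation G n a b) :
    ∃ z, IsStrip (deleteVertex G b) n ⟨a, hG.ne⟩ z := by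
  obtain ⟨hconn, R, -, hR⟩ := hG.triangulation
  -- the neighbours of `a`
  obtain ⟨x₀, hx₀⟩ : ∃ x, G.Adj a x := by
    rw [← SimpleGraph.degree_pos_iff_exists_adj, hG.degree_a]
    omega
  obtain ⟨u, -, hu⟩ := RotationSystem.exists_next_sequence (R := R) hx₀
  obtain ⟨hueq, huall⟩ := RotationSystem.next_sequence hu
  rw [hG.degree_a] at hueq
  have hua : ∀ i, G.Adj a (u i) := fun i => (hu i).adj
  have hub : ∀ i, ¬ G.Adj b (u i) := fun i h => hG.no_common_neighbour _ ⟨hua i, h⟩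
  have hdu : ∀ i, G.degree (u i) = 5 := fun i => hG.degree_other _ (hua i).ne'
    (fun h => hG.not_adj (h ▸ hua i))
  -- the third corners of the triangles on the edges of the rim
  have hw : ∀ i, ∃ w, R.Next (u i) w (u (i + 1)) := fun i =>
    RotationSystem.exists_prev ((hu i).triangle hR).2.adj
  choose w hw using hw
  -- Four consecutive corners at `u (i + 1)` are known, with neighbours `w (i + 1)`, `u (i + 2)`,
  -- `a`, `u i`, `w i`. Degree 5 closes the rotation, so the last corner is a triangle containing `w
  -- i` and `w (i + 1)`.
  have hu5 := fun i => RotationSystem.next_of_degree_five (hdu (i + 1)) (hw (i + 1))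
    ((hu (i + 1)).triangle hR).2 ((hu i).triangle hR).1 ((hw i).triangle hR).1
  have hdw : ∀ i, G.degree (w i) = 5 := by
    intro i
    apply hG.degree_other
    · have := (hu5 i).2.2.2.2.2
      exact this.symm
    · intro h
      exact hub i (h ▸ (hw i).adj.symm)
  -- the common neighbour of these corners
  have hq : ∀ i, ∃ q, R.Next (w (i + 1)) (w i) q := fun i =>
    RotationSystem.exists_next ((hu5 i).1.triangle hR).1.adj'
  choose q hq using hq
  have hw5 := fun i => RotationSystem.next_of_degree_five (hdw (i + 1))
    ((hu5 (i + 1)).1.triangle hR).2 ((hw (i + 1)).triangle hR).2 ((hu5 i).1.triangle hR).1 (hq i)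
  -- Degree 5 at `w (i + 1)` makes `q i` the predecessor of `w (i + 2)` there, and the triangle
  -- defining `q (i + 1)` gives the same position.
  have hqc : ∀ i, q (i + 1) = q i := fun i =>
    ((hq (i + 1)).triangle hR).2.left_unique (hw5 i).1
  have hq0 : ∀ i, q i = q 0 := by
    intro i
    induction i using Int.induction_on with
    | zero => rfl
    | succ i ih => rw [hqc, ih]
    | pred i ih => rw [← ih, ← hqc, sub_add_cancel]
  -- Seen from `q 0`, the outer cycle is traversed in the opposite direction.
  have hqw : ∀ i, R.Next (q 0) (w (-i)) (w (-(i + 1))) := by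
    intro i
    have := ((hq (-i - 1)).triangle hR).1
    rwa [hq0, sub_add_cancel, show -i - 1 = -(i + 1) by ring] at this
  obtain ⟨hweq, hwall⟩ := RotationSystem.next_sequence hqw
  have huN : ∀ i v, G.Adj (u i) v ↔
      v = a ∨ v = u (i + 1) ∨ v = u (i - 1) ∨ v = w i ∨ v = w (i - 1) := by
    intro i v
    obtain ⟨j, rfl⟩ : ∃ j, i = j + 1 := ⟨i - 1, by ring⟩
    rw [add_sub_cancel_right]
    constructor
    · intro h
      rcases (hu5 j).2.1 v h with h | h | h | h | h <;> simp [h]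
    · rintro (rfl | rfl | rfl | rfl | rfl)
      · exact (hua _).symm
      · exact (hw _).adj'
      · exact ((hu j).triangle hR).1.adj'
      · exact (hw _).adj
      · exact (hu5 j).1.adj
  have hwN : ∀ i v, G.Adj (w i) v ↔
      v = q 0 ∨ v = u i ∨ v = u (i + 1) ∨ v = w (i - 1) ∨ v = w (i + 1) := by
    intro i v
    obtain ⟨j, rfl⟩ : ∃ j, i = j + 1 := ⟨i - 1, by ring⟩
    rw [add_sub_cancel_right, ← hq0 j]
    constructor
    · intro h
      rcases (hw5 j).2.1 v h with h | h | h | h | h <;> simp [h]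
    · rintro (rfl | rfl | rfl | rfl | rfl)
      · exact (hq _).adj'
      · exact ((hw _).triangle hR).2.adj'
      · exact ((hw _).triangle hR).2.adj
      · exact (hq _).adj
      · exact (hw5 j).1.adj'
  -- The vertices found so far are closed under adjacency, so by connectedness they are all the
  -- vertices.
  have hcover : ∀ v, v = a ∨ v = q 0 ∨ (∃ i, v = u i) ∨ ∃ i, v = w i := by
    have hstep : ∀ v v', G.Adj v v' → (v' = a ∨ v' = q 0 ∨ (∃ i, v' = u i) ∨ ∃ i, v' = w i) →
        v = a ∨ v = q 0 ∨ (∃ i, v = u i) ∨ ∃ i, v = w i := by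
      rintro v v' h (rfl | rfl | ⟨i, rfl⟩ | ⟨i, rfl⟩)
      · exact Or.inr (Or.inr (Or.inl (huall v h.symm)))
      · obtain ⟨i, hi⟩ := hwall v h.symm
        exact Or.inr (Or.inr (Or.inr ⟨_, hi⟩))
      · rcases (huN i v).1 h.symm with h | h | h | h | h
        · exact Or.inl h
        all_goals first
          | exact Or.inr (Or.inr (Or.inl ⟨_, h⟩))
          | exact Or.inr (Or.inr (Or.inr ⟨_, h⟩))
      · rcases (hwN i v).1 h.symm with h | h | h | h | h
        · exact Or.inr (Or.inl h)
        all_goals first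
          | exact Or.inr (Or.inr (Or.inl ⟨_, h⟩))
          | exact Or.inr (Or.inr (Or.inr ⟨_, h⟩))
    have hwalk : ∀ v v' (_ : G.Walk v v'),
        (v' = a ∨ v' = q 0 ∨ (∃ i, v' = u i) ∨ ∃ i, v' = w i) →
        v = a ∨ v = q 0 ∨ (∃ i, v = u i) ∨ ∃ i, v = w i := by
      intro v v' p
      induction p with
      | nil => exact id
      | cons h p ih => exact fun h' => hstep _ _ h (ih h')
    intro v
    obtain ⟨p⟩ := hconn.preconnected v a
    exact hwalk v a p (Or.inl rfl)
  -- The vertex `b` is neither `a` nor on the rim, and it is no `w i` because it has no neighbour on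
  -- the rim.
  have hbq : b = q 0 := by
    rcases hcover b with h | h | ⟨i, h⟩ | ⟨i, h⟩
    · exact absurd h.symm hG.ne
    · exact h
    · exact absurd (h ▸ hua i) hG.not_adj
    · exact absurd ((hw i).adj.symm) (h ▸ hub i)
  rw [← hbq] at hweq hcover
  simp only [← hbq] at hwN
  rw [hG.degree_b] at hweq
  have hwb : ∀ i, G.Adj (w i) b := fun i => (hwN i b).2 (Or.inl rfl)
  have huw : ∀ i j, u i ≠ w j := fun i j h => hub i (h ▸ (hwb j).symm)
  have hub' : ∀ i, u i ≠ b := fun i h => hG.not_adj (h ▸ hua i)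
  have hwa : ∀ i, w i ≠ a := fun i h => hG.not_adj (h ▸ hwb i)
  have hweq' : ∀ i j, w i = w j ↔ (n : ℤ) ∣ i - j := by
    intro i j
    have := hweq (-i) (-j)
    rw [neg_neg, neg_neg] at this
    rw [this, ← dvd_neg]
    ring_nf
  let f : ℤ → V := fun t => if t % 2 = 0 then u (t / 2) else w (t / 2)
  have f0 : ∀ i, f (2 * i) = u i := fun i => by
    simp only [f]
    rw [if_pos (by omega)]
    congr 1
    omega
  have f1 : ∀ i, f (2 * i + 1) = w i := fun i => by
    simp only [f]
    rw [if_neg (by omega)]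
    congr 1
    omega
  have fb : ∀ t, f t ≠ b := by
    intro t
    obtain ⟨i, rfl | rfl⟩ := Int.even_or_odd' t
    · rw [f0]
      exact hub' i
    · rw [f1]
      exact (hwb i).ne
  have hval : ∀ (v : {v : V // v ≠ b}) t, v = ⟨f t, fb t⟩ ↔ (v : V) = f t := fun v t =>
    Subtype.ext_iff
  refine ⟨fun t => ⟨f t, fb t⟩, hn, ?_, ?_, ?_, ?_, ?_⟩
  · intro t
    rw [Subtype.mk.injEq]
    obtain ⟨i, rfl | rfl⟩ := Int.even_or_odd' t
    · rw [← mul_add, f0, f0, hueq]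
      simp
    · rw [add_right_comm, ← mul_add, f1, f1, hweq']
      simp
  · intro s t h
    rw [Subtype.mk.injEq] at h
    obtain ⟨i, rfl | rfl⟩ := Int.even_or_odd' s <;> obtain ⟨j, rfl | rfl⟩ := Int.even_or_odd' t
    · rw [f0, f0, hueq] at h
      rw [← mul_sub]
      exact mul_dvd_mul_left 2 h
    · rw [f0, f1] at h
      exact absurd h (huw i j)
    · rw [f0, f1] at h
      exact absurd h.symm (huw j i)
    · rw [f1, f1, hweq'] at h
      rw [add_sub_add_right_eq_sub, ← mul_sub]
      exact mul_dvd_mul_left 2 h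
  · intro t h
    rw [Subtype.mk.injEq] at h
    obtain ⟨i, rfl | rfl⟩ := Int.even_or_odd' t
    · rw [f0] at h
      exact (hua i).ne h.symm
    · rw [f1] at h
      exact hwa i h
  · rintro ⟨v, hv⟩
    rcases hcover v with h | h | ⟨i, h⟩ | ⟨i, h⟩
    · exact Or.inl (Subtype.ext h)
    · exact absurd h hv
    · exact Or.inr ⟨2 * i, Subtype.ext (h.trans (f0 i).symm)⟩
    · exact Or.inr ⟨2 * i + 1, Subtype.ext (h.trans (f1 i).symm)⟩
  · rintro t ⟨v, hv⟩
    change G.Adj (f t) v ↔ _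
    simp only [hval, Subtype.mk.injEq]
    obtain ⟨i, rfl | rfl⟩ := Int.even_or_odd' t
    · rw [f0, huN, f1, show 2 * i - 1 = 2 * (i - 1) + 1 by ring, f1,
        show 2 * i + 2 = 2 * (i + 1) by ring, f0, show 2 * i - 2 = 2 * (i - 1) by ring, f0]
      simp only [even_two, Even.mul_right, and_true]
      tauto
    · rw [f1, hwN, show 2 * i + 1 + 1 = 2 * (i + 1) by ring, f0,
        show 2 * i + 1 - 1 = 2 * i by ring, f0, show 2 * i + 1 + 2 = 2 * (i + 1) + 1 by ring, f1,
        show 2 * i + 1 - 2 = 2 * (i - 1) + 1 by ring, f1]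
      have : ¬ Even (2 * i + 1) := by simp
      simp only [this, and_false, hv]
      tauto

end KempeH

/-! ### The theorem for four colours -/

theorem theorem2p1 {V : Type*} [Fintype V] (G : SimpleGraph V) [DecidableRel G.Adj]
    (n : ℕ) (hn : 5 ≤ n) (a b : V) (hG : KempeH.IsPolarTriangulation G n a b) :
    (∀ A B : (KempeH.deleteVertex G b).Coloring (Fin 4),
      (n % 3 = 0 → KempeH.KempeEquivalentWithin (6 * (n / 2)) A B) ∧
      (n % 3 = 2 → KempeH.KempeEquivalentWithin (9 * (n / 2)) A B) ∧
      (n % 3 = 1 → KempeH.KempeEquivalentWithin (9 * (n / 2) + 6 * (n / 3) - 2) A B)) ∧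
    (∀ A B : (KempeH.deleteVertex G b).Coloring (Fin 4),
      KempeH.KempeEquivalent A B ∧ KempeH.KempeEquivalentWithin (13 * n / 2) A B) := by
  obtain ⟨z, hz⟩ := hG.exists_isStrip hn
  have hcol : ∀ A : (KempeH.deleteVertex G b).Coloring (Fin 4),
      ∃ P : Fin 4 ≃ Option (ZMod 3), KempeH.recolour P A ⟨a, hG.ne⟩ = none := by
    intro A
    have e : Fin 4 ≃ Option (ZMod 3) := Fintype.equivOfCardEq (by simp [ZMod.card])
    -- Any bijection of the colours, followed by a swap, sends the colour of `a` to `none`.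
    exact ⟨e.trans (Equiv.swap (e (A ⟨a, hG.ne⟩)) none), by simp⟩
  have main : ∀ A B : (KempeH.deleteVertex G b).Coloring (Fin 4),
      (n % 3 = 0 → KempeH.KempeEquivalentWithin (6 * (n / 2)) A B) ∧
      (n % 3 = 2 → KempeH.KempeEquivalentWithin (9 * (n / 2)) A B) ∧
      (n % 3 = 1 → KempeH.KempeEquivalentWithin (9 * (n / 2) + 6 * (n / 3) - 2) A B) := by
    intro A B
    obtain ⟨P, hP⟩ := hcol A
    obtain ⟨Q, hQ⟩ := hcol B
    obtain ⟨h0, h2, h1⟩ := hz.kempeEquivalentWithin hP hQ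
    exact ⟨fun h => (h0 h).of_recolour, fun h => (h2 h).of_recolour, fun h => (h1 h).of_recolour⟩
  refine ⟨main, fun A B => ?_⟩
  have h : KempeH.KempeEquivalentWithin (13 * n / 2) A B := by
    obtain ⟨h0, h2, h1⟩ := main A B
    rcases (show n % 3 = 0 ∨ n % 3 = 2 ∨ n % 3 = 1 by omega) with h | h | h
    · exact (h0 h).mono (by omega)
    · exact (h2 h).mono (by omega)
    · exact (h1 h).mono (by omega)
  exact ⟨h.kempeEquivalent, h⟩
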